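/- Let $E/\mathbb{Q}$ be an elliptic curve of conductor $N$, let $\varphi : X_0(N)\to E$ be a modular parametrization (a non-constant map on $X_0(N)$ given by composing an Eichler integral of the newform $f_E$ attached to $E$, up to a non-zero factor and an additive constant, with a complex uniformization of $E$), and let $P\in E(\mathbb{C})$. Let $\mathcal{P}$ be a non-cuspidal point of $X_0(N)$ with $\varphi(\mathcal{P})=P$. Suppose that $\mathcal{P}$ corresponds to a pair $(e,c)$ defined over a number field $K\subset\mathbb{C}$: $e$ is an elliptic curve over $K$, $c\subset e(\mathbb{C})$ is a cyclic subgroup of order $N$ that is stable under $\mathrm{Aut}(\mathbb{C}/K)$, and, for some $\tau$ in the upper half-plane representing $\mathcal{P}$, $(e,c)$ is isomorphic over $\mathbb{C}$ to $(\mathbb{C}/(\mathbb{Z}+\mathbb{Z}\tau),\langle 1/N\rangle)$. Then for every $m\,\|\,N$ (that is, $m\mid N$ and $\gcd(m,N/m)=1$) at least one of the following holds: 1. there are an elliptic curve $e'$ over $K$ and an isogeny $e\to e'$ defined over $K$ whose kernel is the cyclic group $c[m]=\{Q\in c : mQ=0\}$ of order $m$, where moreover, if $m>1$, $e'$ is not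 isomorphic to $e$ over $\mathbb{C}$; 2. $e$ has complex multiplication by an order of discriminant $D$ (that is, the ring of endomorphisms of $e$ over $\mathbb{C}$ is isomorphic to the imaginary quadratic order of discriminant $D$), where $0\le -D\le 4m$ and $D$ is a square modulo $4m$. -/

import Mathlib

open scoped WeierstrassCurve.Affine

noncomputable section

namespace ModularPoint

open WeierstrassCurve UpperHalfPlane NumberField

/-! ### The conductor of an elliptic curve over `ℚ`

The exponent of the conductor at a prime `p` is `ε + δ`, where the tame part `ε` is read off from
the reduction type of a minimal model over `ℤ_p` and the wild part `δ` is the Swan conductor of the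
Galois module `E[ℓ]` for a prime `ℓ ≠ p`. -/

open Classical in
/-- The tame part of the conductor exponent at `p`: it is `0`, `1` or `2` according as the reduction
at `p` is good, multiplicative or additive. -/
def tameExponent (E : WeierstrassCurve ℚ) (p : ℕ) [Fact p.Prime] : ℕ :=
  if ((E.baseChange ℚ_[p]).minimal ℤ_[p]).HasGoodReduction ℤ_[p] then 0
  else if ((E.baseChange ℚ_[p]).minimal ℤ_[p]).HasMultiplicativeReduction ℤ_[p] then 1
  else 2

open Classical in
/-- The field `ℚ(E[ℓ])` generated over `ℚ` by the coordinates of the `ℓ`-torsion points. -/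
def torsionField (E : WeierstrassCurve ℚ) (ℓ : ℕ) : IntermediateField ℚ (AlgebraicClosure ℚ) :=
  IntermediateField.adjoin ℚ
    {z | ∃ x y, ∃ h : (E.baseChange (AlgebraicClosure ℚ)).toAffine.Nonsingular x y,
      ℓ • (Affine.Point.some x y h : (E.baseChange (AlgebraicClosure ℚ)).toAffine.Point) = 0 ∧
        (z = x ∨ z = y)}

/-- The Galois group of `ℚ(E[ℓ])` over `ℚ`. -/
abbrev torsionGal (E : WeierstrassCurve ℚ) (ℓ : ℕ) : Type :=
  torsionField E ℓ ≃ₐ[ℚ] torsionField E ℓ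

/-- The ramification group `G_i` (lower numbering) of a prime `𝔓` of `ℚ(E[ℓ])`, consisting of the
`σ` with `σ x ≡ x` modulo `𝔓 ^ (i + 1)` for all integers `x`. -/
def ramificationGroup (E : WeierstrassCurve ℚ) (ℓ : ℕ) (𝔓 : Ideal (𝓞 (torsionField E ℓ))) (i : ℕ) :
    Subgroup (torsionGal E ℓ) :=
  (Submodule.toAddSubgroup (𝔓 ^ (i + 1))).inertia (torsionGal E ℓ)

open Classical in
/-- The points of `E[ℓ]` that are fixed by a subgroup `H` of the Galois group of `ℚ(E[ℓ])`. -/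
def fixedTorsion (E : WeierstrassCurve ℚ) (ℓ : ℕ) (H : Subgroup (torsionGal E ℓ)) :
    AddSubgroup (E.baseChange (torsionField E ℓ)).toAffine.Point :=
  AddSubgroup.torsionBy _ (ℓ : ℤ) ⊓
    ⨅ σ ∈ H, (Affine.Point.map (W' := E) (σ : torsionField E ℓ →ₐ[ℚ] torsionField E ℓ)
      - AddMonoidHom.id _).ker

open Classical in
/-- The dimension over `𝔽_ℓ` of `E[ℓ] / E[ℓ]^H`. -/
def movedDim (E : WeierstrassCurve ℚ) (ℓ : ℕ) (H : Subgroup (torsionGal E ℓ)) : ℕ :=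
  Nat.log ℓ ((fixedTorsion E ℓ H).relIndex (fixedTorsion E ℓ ⊥))

/-- The Swan conductor `∑_{i ≥ 1} (|G_i| / |G_0|) dim (E[ℓ] / E[ℓ]^{G_i})` of `E[ℓ]` at `𝔓`
(almost all terms are zero). -/
def wildExponent (E : WeierstrassCurve ℚ) (ℓ : ℕ) (𝔓 : Ideal (𝓞 (torsionField E ℓ))) : ℚ :=
  ∑ᶠ i : ℕ, (Nat.card (ramificationGroup E ℓ 𝔓 (i + 1)) : ℚ) / Nat.card (ramificationGroup E ℓ 𝔓 0)
    * movedDim E ℓ (ramificationGroup E ℓ 𝔓 (i + 1))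

/-- `N` is the conductor of the elliptic curve `E` over `ℚ`. The auxiliary prime `ℓ ≠ p` and the
prime `𝔓` above `p` may be chosen at will: the wild exponent does not depend on them. -/
def IsConductor (E : WeierstrassCurve ℚ) (N : ℕ) : Prop :=
  N ≠ 0 ∧ ∀ (p : ℕ) [Fact p.Prime], ∃ ℓ : ℕ, ℓ.Prime ∧ ℓ ≠ p ∧
    ∃ 𝔓 : Ideal (𝓞 (torsionField E ℓ)), 𝔓.IsPrime ∧ (p : 𝓞 (torsionField E ℓ)) ∈ 𝔓 ∧
      (N.factorization p : ℚ) = tameExponent E p + wildExponent E ℓ 𝔓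

/-! ### Complex uniformization, `X_0(N)` and modular parametrizations -/

/-- The `x`-coordinate of a point (with value `0` at the point at infinity). -/
def xCoord {W : WeierstrassCurve ℂ} : W.toAffine.Point → ℂ
  | .zero => 0
  | .some x _ _ => x

/-- The `y`-coordinate of a point (with value `0` at the point at infinity). -/
def yCoord {W : WeierstrassCurve ℂ} : W.toAffine.Point → ℂ
  | .zero => 0
  | .some _ y _ => y

/-- `π` induces an isomorphism of complex Lie groups `ℂ / (ℤ + ℤ τ) ≅ W(ℂ)`: it is a surjective
homomorphism with kernel `ℤ + ℤ τ` whose coordinates are holomorphic off the kernel. -/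
structure IsUniformization (W : WeierstrassCurve ℂ) (τ : ℍ) (π : ℂ →+ W.toAffine.Point) :
    Prop where
  surjective : Function.Surjective π
  ker_eq : π.ker = AddSubgroup.closure {1, (τ : ℂ)}
  differentiableAt_x : ∀ z, π z ≠ 0 → DifferentiableAt ℂ (fun w ↦ xCoord (π w)) z
  differentiableAt_y : ∀ z, π z ≠ 0 → DifferentiableAt ℂ (fun w ↦ yCoord (π w)) z

/-- The non-cuspidal complex points `Γ_0(N) \ ℍ` of the modular curve `X_0(N)`. -/
abbrev Y0 (N : ℕ) : Type := MulAction.orbitRel.Quotient (CongruenceSubgroup.Gamma0 N) ℍ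

/-- The point of `X_0(N)` represented by `τ`. -/
def Y0.mk (N : ℕ) (τ : ℍ) : Y0 N :=
  Quotient.mk (MulAction.orbitRel (CongruenceSubgroup.Gamma0 N) ℍ) τ

/-- The point `x₀` of `X_0(N)` corresponds to the pair `(W, c)`: if `x₀` is represented by `τ`, then
`(W, c)` is isomorphic to `(ℂ / (ℤ + ℤ τ), ⟨1 / N⟩)`. In particular `c` is cyclic of order `N`. -/
def CorrespondsTo {N : ℕ} (x₀ : Y0 N) (W : WeierstrassCurve ℂ) (c : AddSubgroup W.toAffine.Point) :
    Prop :=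
  ∃ τ : ℍ, Y0.mk N τ = x₀ ∧ ∃ π : ℂ →+ W.toAffine.Point, IsUniformization W τ π ∧
    c = AddSubgroup.zmultiples (π (1 / (N : ℂ)))

/-- `f` is the weight two newform attached to the elliptic curve `E` of conductor `N`: a cusp form on
`Γ_0(N)` whose Fourier coefficients are the coefficients of the `L`-series of `E`. -/
def IsAttachedNewform (E : WeierstrassCurve ℚ) (N : ℕ)
    (f : CuspForm ((CongruenceSubgroup.Gamma0 N).map (Matrix.SpecialLinearGroup.mapGL ℝ)) 2) :
    Prop :=
  ∀ n : ℕ, (qExpansion 1 f).coeff n = (E.LFunction n : ℂ)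

/-- `φ` is (the restriction to the non-cuspidal points of) a modular parametrization
`X_0(N) → E`: it is the composite of a primitive `F` of a non-zero multiple of the newform `f` of
`E` (an Eichler integral of `f`) with a complex uniformization of `E`. -/
def IsModularParametrization (E : WeierstrassCurve ℚ) (N : ℕ)
    (φ : Y0 N → (E.baseChange ℂ).toAffine.Point) : Prop :=
  ∃ f : CuspForm ((CongruenceSubgroup.Gamma0 N).map (Matrix.SpecialLinearGroup.mapGL ℝ)) 2,
    IsAttachedNewform E N f ∧
    ∃ (a : ℂ) (F : ℍ → ℂ) (τ : ℍ) (π : ℂ →+ (E.baseChange ℂ).toAffine.Point), a ≠ 0 ∧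
      (∀ z : ℍ, HasDerivAt (fun w : ℂ ↦ F (ofComplex w)) (a * f z) z) ∧
      IsUniformization (E.baseChange ℂ) τ π ∧ ∀ z : ℍ, φ (Y0.mk N z) = π (F z)

/-! ### Isogenies and complex multiplication -/

/-- A subgroup `c` of `e(ℂ)` is defined over `K ⊆ ℂ` if it is stable under `Aut(ℂ/K)`. -/
def IsDefinedOver {K : Type*} [Field K] [Algebra K ℂ] (e : WeierstrassCurve K)
    (c : AddSubgroup (e.baseChange ℂ).toAffine.Point) : Prop :=
  ∀ σ : ℂ ≃ₐ[K] ℂ, ∀ Q ∈ c, Affine.Point.map (W' := e) (σ : ℂ →ₐ[K] ℂ) Q ∈ c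

/-- A homomorphism `ψ : W(ℂ) → W'(ℂ)` is an isogeny defined over the field `k ⊆ ℂ` if, outside a
finite set, it is given in coordinates by rational functions `x' = a / b`, `y' = r / s` of `(x, y)`
with coefficients in `k`. (In particular `ψ ≠ 0`.) -/
def IsIsogeny (k : Type*) [Field k] [Algebra k ℂ] {W W' : WeierstrassCurve ℂ}
    (ψ : W.toAffine.Point →+ W'.toAffine.Point) : Prop :=
  ∃ a b r s : MvPolynomial (Fin 2) k,
    {Q : W.toAffine.Point | ¬ (Q ≠ 0 ∧ ψ Q ≠ 0 ∧
      MvPolynomial.aeval ![xCoord Q, yCoord Q] b ≠ 0 ∧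
      MvPolynomial.aeval ![xCoord Q, yCoord Q] s ≠ 0 ∧
      xCoord (ψ Q) =
        MvPolynomial.aeval ![xCoord Q, yCoord Q] a / MvPolynomial.aeval ![xCoord Q, yCoord Q] b ∧
      yCoord (ψ Q) =
        MvPolynomial.aeval ![xCoord Q, yCoord Q] r /
          MvPolynomial.aeval ![xCoord Q, yCoord Q] s)}.Finite

/-- An `m`-isogeny defined over `k`: an isogeny over `k` with cyclic kernel of order `m`. -/
def IsCyclicIsogeny (k : Type*) [Field k] [Algebra k ℂ] (m : ℕ) {W W' : WeierstrassCurve ℂ}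
    (ψ : W.toAffine.Point →+ W'.toAffine.Point) : Prop :=
  IsIsogeny k ψ ∧ IsAddCyclic ψ.ker ∧ Nat.card ψ.ker = m

/-- `W` has complex multiplication by the order of discriminant `D`: here `D < 0` is a discriminant
`b ^ 2 + 4 a`, and the ring of all endomorphisms of `W` (zero and the isogenies from `W` to itself)
is isomorphic to the quadratic order `ℤ[ω]`, `ω ^ 2 = a + b ω`, of discriminant `D`. -/
def HasCMByDiscriminant (W : WeierstrassCurve ℂ) (D : ℤ) : Prop :=
  D < 0 ∧ ∃ a b : ℤ, b ^ 2 + 4 * a = D ∧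
    ∃ f : QuadraticAlgebra ℤ a b →+* AddMonoid.End W.toAffine.Point, Function.Injective f ∧
      ∀ ψ : W.toAffine.Point →+ W.toAffine.Point, (∃ α, f α = ψ) ↔ ψ = 0 ∨ IsIsogeny ℂ ψ

end ModularPoint

end

/-!
Let `G` be the subgroup of order `m` of `c`. It is stable under the automorphisms of `ℂ` over `K`,
as `c` is. If the quotient `e' = e / G` is not isomorphic to `e` over `ℂ`, or if `m = 1`, then the
quotient map is the isogeny of the first alternative. Otherwise, composition of the quotient map
with such an isomorphism is an endomorphism of `e` with cyclic kernel of order `m`, and this forces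
complex multiplication.

*The quotient over `ℂ`.* With a uniformization `π : ℂ → e(ℂ)`, the function
`z ↦ ∑ Q ∈ G, x (π z + Q)` and its derivative satisfy a Weierstrass equation
(`IsUniformization.exists_isWeierstrassPair_sum`), since an even elliptic function with poles at the
lattice points only is a polynomial in any such function with a double pole
(`IsEvenElliptic.exists_polynomial`). The addition theorem makes the resulting parametrization of
the curve `e'` a homomorphism with kernel `π⁻¹(G)` (`IsWeierstrassPair.exists_addMonoidHom`).

*Descent to `K`.* By the addition formulas the sum is a rational function of `x`, whose numerator
and denominator are written down explicitly (`sum_xCoord_add_eq`) and are visibly fixed by the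
automorphisms of `ℂ` over `K`; so are the coefficients of the equation of `e'`. The fixed field of
these automorphisms is `K` (`mem_range_of_fixed`), so that `e'` and the isogeny are defined over `K`
(`exists_isogeny`).

*Complex multiplication.* If `e'` is isomorphic to `e`, then some `α` maps the lattice
`ℤ (1 / m) + ℤ τ` onto `ℤ + ℤ τ` (`IsUniformization.exists_homothety`). In terms of these bases `α`
is an integral matrix of determinant `1`. For `m > 1` this gives an integral quadratic form of
discriminant `t ^ 2 - 4 * m` with root `τ`. Dividing the form by its content `g`, which is prime to
`m`, leaves a primitive form `(a, b, c)` with `m ∣ a`, whose discriminant `D = b ^ 2 - 4 * a * c` is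
negative, at least `-4 * m` and a square modulo `4 * m`
(`IsUniformization.exists_hasCMByDiscriminant`). The multiplier ring of `ℤ + ℤ τ` is the order of
discriminant `D`, and the endomorphisms of `e`, being given by rational functions, are exactly the
multiplications by its elements (`IsUniformization.hasCMByDiscriminant`).
-/

open scoped WeierstrassCurve.Affine

noncomputable section

namespace ModularPoint

open WeierstrassCurve UpperHalfPlane NumberField

open Filter Topology Polynomial

/-! ### Functions that are periodic under a lattice -/

/-- A lattice in `ℂ`: a discrete subgroup that contains `1` and a number which is not real. -/
structure IsPeriodLattice (L : AddSubgroup ℂ) : Prop where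
  discrete : DiscreteTopology L
  one_mem : (1 : ℂ) ∈ L
  exists_im_ne_zero : ∃ τ ∈ L, τ.im ≠ 0

namespace IsPeriodLattice

variable {L : AddSubgroup ℂ}

lemma isClosed (hL : IsPeriodLattice L) : IsClosed (L : Set ℂ) :=
  have := hL.discrete
  AddSubgroup.isClosed_of_discrete

lemma countable (hL : IsPeriodLattice L) : (L : Set ℂ).Countable := by
  have : DiscreteTopology (L : Set ℂ) := hL.discrete
  exact Set.countable_coe_iff.mp (TopologicalSpace.separableSpace_iff_countable.mp inferInstance)

lemma eventually_notMem_nhds (hL : IsPeriodLattice L) {z : ℂ} (hz : z ∉ L) :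
    ∀ᶠ w in 𝓝 z, w ∉ L :=
  hL.isClosed.isOpen_compl.mem_nhds hz

lemma eventually_notMem (hL : IsPeriodLattice L) (z : ℂ) : ∀ᶠ w in 𝓝[≠] z, w ∉ L := by
  by_cases hz : z ∈ L
  · have h := discreteTopology_subtype_iff.mp (show DiscreteTopology (L : Set ℂ) from hL.discrete)
      z hz
    have h2 := inf_principal_eq_bot.mp h
    exact h2
  · exact (hL.eventually_notMem_nhds hz).filter_mono nhdsWithin_le_nhds

lemma isPreconnected_compl_of_countable {s : Set ℂ} (hs : s.Countable) : IsPreconnected sᶜ :=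
  (hs.isPathConnected_compl_of_one_lt_rank
    (by simp [Complex.rank_real_complex])).isConnected.isPreconnected

lemma isPreconnected_compl (hL : IsPeriodLattice L) : IsPreconnected (L : Set ℂ)ᶜ :=
  isPreconnected_compl_of_countable hL.countable

/-- A lattice has a compact set of representatives, for example a closed parallelogram. -/
lemma exists_isCompact (hL : IsPeriodLattice L) :
    ∃ K : Set ℂ, IsCompact K ∧ ∀ z, ∃ w ∈ K, z - w ∈ L := by
  obtain ⟨τ, hτ, him⟩ := hL.exists_im_ne_zero
  refine ⟨(fun p : ℝ × ℝ ↦ (p.1 + p.2 * τ : ℂ)) '' (Set.Icc 0 1 ×ˢ Set.Icc 0 1),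
    (isCompact_Icc.prod isCompact_Icc).image (by fun_prop), fun z ↦ ?_⟩
  set b : ℝ := z.im / τ.im
  set a : ℝ := z.re - b * τ.re
  have hz : z = a + b * τ := by
    apply Complex.ext
    · simp [a]
    · simp [b, him]
  refine ⟨_, ⟨(Int.fract a, Int.fract b), ⟨⟨Int.fract_nonneg _, (Int.fract_lt_one _).le⟩,
    ⟨Int.fract_nonneg _, (Int.fract_lt_one _).le⟩⟩, rfl⟩, ?_⟩
  have hl : ((⌊a⌋ : ℂ) + ⌊b⌋ * τ) ∈ L := by
    refine L.add_mem ?_ ?_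
    · simpa using L.zsmul_mem hL.one_mem ⌊a⌋
    · simpa using L.zsmul_mem hτ ⌊b⌋
  convert hl using 1
  have ha : (a : ℂ) = ((⌊a⌋ : ℝ) : ℂ) + (Int.fract a : ℝ) := by
    rw [← Complex.ofReal_add, Int.floor_add_fract]
  have hb : (b : ℂ) = ((⌊b⌋ : ℝ) : ℂ) + (Int.fract b : ℝ) := by
    rw [← Complex.ofReal_add, Int.floor_add_fract]
  rw [hz]
  nth_rewrite 1 [ha]
  nth_rewrite 1 [hb]
  push_cast
  ring

/-- Liouville's theorem for doubly periodic entire functions. -/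
lemma eq_of_differentiable (hL : IsPeriodLattice L) {F : ℂ → ℂ} (hF : Differentiable ℂ F)
    (hp : ∀ z, ∀ l ∈ L, F (z + l) = F z) (z w : ℂ) : F z = F w := by
  obtain ⟨K, hK, hKL⟩ := hL.exists_isCompact
  refine hF.apply_eq_apply_of_bounded
    ((hK.image hF.continuous).isBounded.subset ?_) z w
  rintro _ ⟨z, rfl⟩
  obtain ⟨w, hw, hzw⟩ := hKL z
  refine ⟨w, hw, ?_⟩
  rw [← hp w _ hzw, add_sub_cancel]

end IsPeriodLattice

lemma analyticAt_update_of_tendsto {F : ℂ → ℂ} {c l : ℂ}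
    (hd : ∀ᶠ z in 𝓝[≠] c, DifferentiableAt ℂ F z) (hl : Tendsto F (𝓝[≠] c) (𝓝 l)) :
    AnalyticAt ℂ (Function.update F c l) c := by
  refine Complex.analyticAt_of_differentiable_on_punctured_nhds_of_continuousAt ?_
    (continuousAt_update_same.mpr hl)
  filter_upwards [hd, self_mem_nhdsWithin] with z hz hzc
  refine hz.congr_of_eventuallyEq ?_
  filter_upwards [isOpen_ne.mem_nhds hzc] with w hw
  exact Function.update_of_ne hw _ _

/-- A doubly periodic function without poles on the lattice is constant. -/
lemma IsPeriodLattice.eq_of_tendsto {L : AddSubgroup ℂ} (hL : IsPeriodLattice L) {F : ℂ → ℂ}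
    (hF : ∀ z ∉ L, DifferentiableAt ℂ F z) (hp : ∀ z, ∀ l ∈ L, F (z + l) = F z) {l₀ : ℂ}
    (h0 : Tendsto F (𝓝[≠] 0) (𝓝 l₀)) {z : ℂ} (hz : z ∉ L) : F z = l₀ := by
  classical
  let G : ℂ → ℂ := fun z ↦ if z ∈ L then l₀ else F z
  have hGp : ∀ z, ∀ l ∈ L, G (z + l) = G z := by
    intro z l hl
    simp only [G, L.add_mem_cancel_right hl, hp z l hl]
  have hG0 : DifferentiableAt ℂ G 0 := by
    have h1 := analyticAt_update_of_tendsto ((hL.eventually_notMem 0).mono hF) h0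
    refine h1.differentiableAt.congr_of_eventuallyEq ?_
    have := hL.eventually_notMem 0
    rw [eventually_nhdsWithin_iff] at this
    filter_upwards [this] with w hw
    by_cases h : w = 0
    · simp [h, G]
    · simp [G, hw h, h]
  have hG : Differentiable ℂ G := by
    intro w
    by_cases hw : w ∈ L
    · have h1 : G = fun x ↦ G (x - w) := by
        funext x
        rw [sub_eq_add_neg, hGp x _ (L.neg_mem hw)]
      rw [h1]
      have h2 : DifferentiableAt ℂ G (w - w) := by simpa using hG0
      exact DifferentiableAt.comp (f := fun x ↦ x - w) w h2 (by fun_prop)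
    · refine (hF w hw).congr_of_eventuallyEq ?_
      filter_upwards [hL.eventually_notMem_nhds hw] with x hx
      simp [G, hx]
  have h := hL.eq_of_differentiable hG hGp z 0
  simpa [G, hz, L.zero_mem] using h

/-- An even function that is holomorphic off the lattice `L` and `L`-periodic. -/
structure IsEvenElliptic (L : AddSubgroup ℂ) (f : ℂ → ℂ) : Prop where
  differentiableAt : ∀ z ∉ L, DifferentiableAt ℂ f z
  add_mem : ∀ z, ∀ l ∈ L, f (z + l) = f z
  neg : ∀ z, f (-z) = f z

lemma AnalyticAt.exists_tendsto_div_sq {h : ℂ → ℂ} (hh : AnalyticAt ℂ h 0) (h0 : h 0 = 0)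
    (heven : ∀ᶠ z in 𝓝 0, h (-z) = h z) :
    ∃ d, Tendsto (fun z ↦ h z / z ^ 2) (𝓝[≠] 0) (𝓝 d) := by
  have hd : deriv h 0 = 0 := by
    have h1 : deriv (fun z ↦ h (-z)) 0 = deriv h 0 := EventuallyEq.deriv_eq heven
    have h2 : deriv (fun z ↦ h (-z)) 0 = -deriv h 0 := by
      simpa using deriv_comp_neg h (0 : ℂ)
    have h3 : deriv h 0 = -deriv h 0 := h1.symm.trans h2
    exact self_eq_neg.mp h3
  obtain ⟨s, hs, hds⟩ : ∃ s ∈ 𝓝 (0 : ℂ), DifferentiableOn ℂ h s :=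
    ⟨_, hh.eventually_analyticAt, fun z hz ↦
      (AnalyticAt.differentiableAt hz).differentiableWithinAt⟩
  have h1 := (Complex.differentiableOn_dslope hs).mpr hds
  have h2 := ((Complex.differentiableOn_dslope hs).mpr h1).differentiableAt hs
  refine ⟨_, (h2.continuousAt.tendsto.mono_left nhdsWithin_le_nhds).congr' ?_⟩
  filter_upwards [self_mem_nhdsWithin] with z hz
  have hz' : z ≠ 0 := hz
  rw [dslope_of_ne _ hz', slope_def_field, dslope_same, hd, dslope_of_ne _ hz', slope_def_field, h0]
  field_simp
  simp [mul_comm]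

/-- An even elliptic function with a pole of order at most `2 k` at the lattice, and no other poles,
is a polynomial of degree at most `k` in any even elliptic function with a double pole there. -/
theorem IsEvenElliptic.exists_polynomial {L : AddSubgroup ℂ} (hL : IsPeriodLattice L) {f : ℂ → ℂ}
    (hf : IsEvenElliptic L f) {c : ℂ} (hc : c ≠ 0)
    (hfc : Tendsto (fun z ↦ z ^ 2 * f z) (𝓝[≠] 0) (𝓝 c)) (k : ℕ) {F : ℂ → ℂ}
    (hF : IsEvenElliptic L F) {d : ℂ}
    (hFd : Tendsto (fun z ↦ z ^ (2 * k) * F z) (𝓝[≠] 0) (𝓝 d)) :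
    ∃ p : ℂ[X], p.natDegree ≤ k ∧ p.coeff k = d / c ^ k ∧ ∀ z ∉ L, F z = p.eval (f z) := by
  induction k generalizing F d with
  | zero =>
    refine ⟨C d, by simp, by simp, fun z hz ↦ ?_⟩
    rw [eval_C]
    exact hL.eq_of_tendsto hF.differentiableAt hF.add_mem (by simpa using hFd) hz
  | succ k ih =>
    set a : ℂ := d / c ^ (k + 1) with ha
    let F₂ : ℂ → ℂ := fun z ↦ F z - a * f z ^ (k + 1)
    have hF₂ : IsEvenElliptic L F₂ :=
      ⟨fun z hz ↦ (hF.differentiableAt z hz).sub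
          (((hf.differentiableAt z hz).pow _).const_mul a),
        fun z l hl ↦ by simp only [F₂, hF.add_mem z l hl, hf.add_mem z l hl],
        fun z ↦ by simp only [F₂, hF.neg, hf.neg]⟩
    have ht : Tendsto (fun z ↦ z ^ (2 * (k + 1)) * F₂ z) (𝓝[≠] 0) (𝓝 0) := by
      have h1 := hFd.sub ((hfc.pow (k + 1)).const_mul a)
      have h2 : d - a * c ^ (k + 1) = 0 := by rw [ha]; field_simp; ring
      rw [h2] at h1
      refine h1.congr fun z ↦ ?_
      simp only [F₂]
      ring
    have hdiff : ∀ᶠ z in 𝓝[≠] (0 : ℂ), DifferentiableAt ℂ (fun z ↦ z ^ (2 * (k + 1)) * F₂ z) z := by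
      filter_upwards [hL.eventually_notMem 0] with z hz
      exact (differentiableAt_id.pow _).mul (hF₂.differentiableAt z hz)
    have han := analyticAt_update_of_tendsto hdiff ht
    obtain ⟨d', hd'⟩ := AnalyticAt.exists_tendsto_div_sq han (by simp) (Eventually.of_forall (by
      intro z
      by_cases hz : z = 0
      · simp [hz]
      · rw [Function.update_of_ne hz, Function.update_of_ne (neg_ne_zero.mpr hz), hF₂.neg]
        congr 1
        rw [pow_mul, pow_mul, neg_sq]))
    obtain ⟨p, hp, -, hpF⟩ := ih hF₂ (d := d') (hd'.congr' (by
      filter_upwards [self_mem_nhdsWithin] with z hz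
      have hz' : z ≠ 0 := hz
      rw [Function.update_of_ne hz']
      field_simp
      ring))
    refine ⟨p + C a * X ^ (k + 1), ?_, ?_, fun z hz ↦ ?_⟩
    · refine (natDegree_add_le _ _).trans (max_le (hp.trans k.le_succ) ?_)
      exact natDegree_C_mul_X_pow_le _ _
    · rw [coeff_add, coeff_eq_zero_of_natDegree_lt (Nat.lt_succ_of_le hp)]
      simp [ha]
    · rw [eval_add, ← hpF z hz]
      simp [F₂]

/-! ### Coordinates of points -/

/-- The right hand side of the equation `v ^ 2 = x ^ 3 + ⋯` obtained from a Weierstrass equation by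
completing the square, `v = y + (a₁ x + a₃) / 2`. -/
def cubic (W : WeierstrassCurve ℂ) (x : ℂ) : ℂ :=
  x ^ 3 + W.b₂ / 4 * x ^ 2 + W.b₄ / 2 * x + W.b₆ / 4

/-- The derivative of `cubic`. -/
def cubicDeriv (W : WeierstrassCurve ℂ) (x : ℂ) : ℂ :=
  3 * x ^ 2 + W.b₂ / 2 * x + W.b₄ / 2

/-- The coordinate `v = y + (a₁ x + a₃) / 2` of a point, in which `-(x, v) = (x, -v)`
(with value `0` at the point at infinity). -/
def vCoord {W : WeierstrassCurve ℂ} : W.toAffine.Point → ℂ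
  | .zero => 0
  | .some x y _ => y + (W.a₁ * x + W.a₃) / 2

/-- The numerator of `x (P + Q)` over the denominator `(x P - x Q) ^ 2`, as a polynomial in the
coordinates `x` and `v` of `P` and `Q`. -/
def addNumX (W : WeierstrassCurve ℂ) (x₁ v₁ x₂ v₂ : ℂ) : ℂ :=
  x₁ ^ 2 * x₂ + x₁ * x₂ ^ 2 + W.b₂ / 2 * (x₁ * x₂) + W.b₄ / 2 * (x₁ + x₂) + W.b₆ / 2 - 2 * v₁ * v₂

/-- The numerator of `v (P + Q)` over the denominator `(x P - x Q) ^ 3`, as a polynomial in the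
coordinates `x` and `v` of `P` and `Q`. -/
def addNumV (W : WeierstrassCurve ℂ) (x₁ v₁ x₂ v₂ : ℂ) : ℂ :=
  ((2 * x₁ * x₂ + x₂ ^ 2 + W.b₂ / 2 * x₂ + W.b₄ / 2) * v₁ - v₂ * cubicDeriv W x₁) * (x₁ - x₂)
    - 2 * addNumX W x₁ v₁ x₂ v₂ * v₁

section Point

variable {W : WeierstrassCurve ℂ}

@[simp] lemma vCoord_zero : vCoord (0 : W.toAffine.Point) = 0 := rfl

lemma vCoord_eq {P : W.toAffine.Point} (hP : P ≠ 0) :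
    vCoord P = yCoord P + (W.a₁ * xCoord P + W.a₃) / 2 := by
  rcases P with _ | ⟨x, y, h⟩
  · exact absurd rfl hP
  · rfl

@[simp] lemma xCoord_neg (P : W.toAffine.Point) : xCoord (-P) = xCoord P := by
  rcases P with _ | ⟨x, y, h⟩ <;> rfl

@[simp] lemma vCoord_neg (P : W.toAffine.Point) : vCoord (-P) = -vCoord P := by
  rcases P with _ | ⟨x, y, h⟩
  · change (0 : ℂ) = -0
    simp
  · change W.toAffine.negY x y + (W.a₁ * x + W.a₃) / 2 = -(y + (W.a₁ * x + W.a₃) / 2)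
    simp only [Affine.negY]
    ring

lemma vCoord_sq {P : W.toAffine.Point} (hP : P ≠ 0) : vCoord P ^ 2 = cubic W (xCoord P) := by
  rcases P with _ | ⟨x, y, h⟩
  · exact absurd rfl hP
  · change (y + (W.a₁ * x + W.a₃) / 2) ^ 2 = cubic W x
    have h1 := (Affine.equation_iff ..).mp h.left
    simp only [cubic, WeierstrassCurve.b₂, WeierstrassCurve.b₄, WeierstrassCurve.b₆]
    linear_combination h1

lemma point_ext {P Q : W.toAffine.Point} (hP : P ≠ 0) (hQ : Q ≠ 0) (hx : xCoord P = xCoord Q)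
    (hv : vCoord P = vCoord Q) : P = Q := by
  rcases P with _ | ⟨x, y, h⟩
  · exact absurd rfl hP
  rcases Q with _ | ⟨x', y', h'⟩
  · exact absurd rfl hQ
  change x = x' at hx
  change y + (W.a₁ * x + W.a₃) / 2 = y' + (W.a₁ * x' + W.a₃) / 2 at hv
  subst hx
  have : y = y' := by linear_combination hv
  subst this
  rfl

lemma eq_or_eq_neg_of_xCoord_eq {P Q : W.toAffine.Point} (hP : P ≠ 0) (hQ : Q ≠ 0)
    (hx : xCoord P = xCoord Q) : P = Q ∨ P = -Q := by
  have h : (vCoord P - vCoord Q) * (vCoord P + vCoord Q) = 0 := by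
    have h1 := vCoord_sq hP
    rw [hx, ← vCoord_sq hQ] at h1
    linear_combination h1
  rcases mul_eq_zero.mp h with h | h
  · exact Or.inl (point_ext hP hQ hx (sub_eq_zero.mp h))
  · refine Or.inr (point_ext hP (neg_ne_zero.mpr hQ) (by simpa using hx) ?_)
    rw [vCoord_neg]
    exact eq_neg_of_add_eq_zero_left h

lemma vCoord_eq_zero_iff {P : W.toAffine.Point} (hP : P ≠ 0) : vCoord P = 0 ↔ P + P = 0 := by
  constructor
  · intro h
    have : P = -P := point_ext hP (neg_ne_zero.mpr hP) (by simp) (by simp [h])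
    nth_rewrite 1 [this]
    simp
  · intro h
    have h1 : vCoord P = -vCoord P := by
      conv_lhs => rw [eq_neg_of_add_eq_zero_left h, vCoord_neg]
    exact self_eq_neg.mp h1

/-- Every solution of `v ^ 2 = cubic W x` comes from a point: an elliptic curve has no singular
points. -/
lemma exists_point [W.IsElliptic] {x v : ℂ} (h : v ^ 2 = cubic W x) :
    ∃ P : W.toAffine.Point, P ≠ 0 ∧ xCoord P = x ∧ vCoord P = v := by
  have h1 : W.toAffine.Equation x (v - (W.a₁ * x + W.a₃) / 2) := by
    rw [Affine.equation_iff]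
    simp only [cubic, WeierstrassCurve.b₂, WeierstrassCurve.b₄, WeierstrassCurve.b₆] at h
    linear_combination h
  refine ⟨.some x _ ((Affine.equation_iff_nonsingular).mp h1), Affine.Point.some_ne_zero _, rfl, ?_⟩
  change v - (W.a₁ * x + W.a₃) / 2 + (W.a₁ * x + W.a₃) / 2 = v
  ring

/-- The addition formulas for points with distinct `x`-coordinates, in the coordinates `x` and `v`
and with denominators cleared. -/
lemma add_formula {P Q : W.toAffine.Point} (hP : P ≠ 0) (hQ : Q ≠ 0)
    (hx : xCoord P ≠ xCoord Q) : P + Q ≠ 0 ∧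
      xCoord (P + Q) * (xCoord P - xCoord Q) ^ 2 =
        addNumX W (xCoord P) (vCoord P) (xCoord Q) (vCoord Q) ∧
      vCoord (P + Q) * (xCoord P - xCoord Q) ^ 3 =
        addNumV W (xCoord P) (vCoord P) (xCoord Q) (vCoord Q) := by
  rcases P with _ | ⟨x₁, y₁, h₁⟩
  · exact absurd rfl hP
  rcases Q with _ | ⟨x₂, y₂, h₂⟩
  · exact absurd rfl hQ
  change x₁ ≠ x₂ at hx
  rw [Affine.Point.add_of_X_ne hx]
  have hs := Affine.slope_of_X_ne (W := W.toAffine) (y₁ := y₁) (y₂ := y₂) hx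
  refine ⟨Affine.Point.some_ne_zero _, ?_, ?_⟩
  · change W.toAffine.addX x₁ x₂ (W.toAffine.slope x₁ x₂ y₁ y₂) * (x₁ - x₂) ^ 2 =
      addNumX W x₁ (y₁ + (W.a₁ * x₁ + W.a₃) / 2) x₂ (y₂ + (W.a₁ * x₂ + W.a₃) / 2)
    rw [hs]
    have e₁ := (Affine.equation_iff ..).mp h₁.left
    have e₂ := (Affine.equation_iff ..).mp h₂.left
    have hx' : x₁ - x₂ ≠ 0 := sub_ne_zero.mpr hx
    simp only [Affine.addX, addNumX, WeierstrassCurve.b₂, WeierstrassCurve.b₄, WeierstrassCurve.b₆]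
    field_simp
    linear_combination 2 * e₁ + 2 * e₂
  · change (W.toAffine.addY x₁ x₂ y₁ (W.toAffine.slope x₁ x₂ y₁ y₂) +
      (W.a₁ * W.toAffine.addX x₁ x₂ (W.toAffine.slope x₁ x₂ y₁ y₂) + W.a₃) / 2) *
      (x₁ - x₂) ^ 3 = addNumV W x₁ (y₁ + (W.a₁ * x₁ + W.a₃) / 2) x₂ (y₂ + (W.a₁ * x₂ + W.a₃) / 2)
    rw [hs]
    have e₁ := (Affine.equation_iff ..).mp h₁.left
    have e₂ := (Affine.equation_iff ..).mp h₂.left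
    have hx' : x₁ - x₂ ≠ 0 := sub_ne_zero.mpr hx
    simp only [Affine.addX, Affine.addY, Affine.negAddY, Affine.negY, addNumX, addNumV, cubicDeriv,
      WeierstrassCurve.b₂, WeierstrassCurve.b₄, WeierstrassCurve.b₆]
    field_simp
    linear_combination 4 * (-(y₁ + (W.a₁ * x₁ + W.a₃) / 2) - (y₂ + (W.a₁ * x₂ + W.a₃) / 2)) * e₁ +
      4 * (-3 * (y₁ + (W.a₁ * x₁ + W.a₃) / 2) + (y₂ + (W.a₁ * x₂ + W.a₃) / 2)) * e₂

end Point

/-! ### Pairs of elliptic functions that satisfy a Weierstrass equation -/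

/-- The identity theorem off a closed countable set `s`, whose complement is connected. -/
lemma eq_zero_of_eventually_eq_zero {s : Set ℂ} (hs : s.Countable) (hc : IsClosed s) {F : ℂ → ℂ}
    (hF : ∀ z ∉ s, DifferentiableAt ℂ F z) {a : ℂ} (hs' : ∀ᶠ z in 𝓝[≠] a, z ∉ s)
    (h : ∀ᶠ z in 𝓝[≠] a, F z = 0) {z : ℂ} (hz : z ∉ s) : F z = 0 := by
  have han : AnalyticOnNhd ℂ F sᶜ := DifferentiableOn.analyticOnNhd
    (fun z hz ↦ (hF z hz).differentiableWithinAt) hc.isOpen_compl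
  obtain ⟨b, ⟨hb, hbs⟩, hba⟩ :=
    (((eventually_eventually_nhdsWithin.mpr h).and hs').and self_mem_nhdsWithin).exists
  have hb' : ∀ᶠ x in 𝓝 b, F x = 0 := by
    rwa [isOpen_compl_singleton.nhdsWithin_eq hba] at hb
  exact han.eqOn_zero_of_preconnected_of_eventuallyEq_zero
    (IsPeriodLattice.isPreconnected_compl_of_countable hs) hbs hb' hz

/-- The leading term of the derivative at a double pole. -/
lemma tendsto_cube_mul_deriv {f f' : ℂ → ℂ} {c : ℂ}
    (hf : ∀ᶠ z in 𝓝[≠] 0, HasDerivAt f (f' z) z)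
    (hc : Tendsto (fun z ↦ z ^ 2 * f z) (𝓝[≠] 0) (𝓝 c)) :
    Tendsto (fun z ↦ z ^ 3 * f' z) (𝓝[≠] 0) (𝓝 (-2 * c)) := by
  have hd : ∀ᶠ z in 𝓝[≠] 0, HasDerivAt (fun z ↦ z ^ 2 * f z) (2 * z * f z + z ^ 2 * f' z) z := by
    filter_upwards [hf] with z hz
    exact ((hasDerivAt_pow 2 z).mul hz).congr_deriv (by simp)
  have han := analyticAt_update_of_tendsto (hd.mono fun z hz ↦ hz.differentiableAt) hc
  set h := Function.update (fun z ↦ z ^ 2 * f z) 0 c with hh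
  have h1 : Tendsto (deriv h) (𝓝[≠] 0) (𝓝 (deriv h 0)) :=
    han.deriv.continuousAt.tendsto.mono_left nhdsWithin_le_nhds
  have h2 : Tendsto (fun z : ℂ ↦ z) (𝓝[≠] 0) (𝓝 0) := tendsto_id.mono_left nhdsWithin_le_nhds
  have h3 := (h2.mul h1).sub (hc.const_mul 2)
  rw [zero_mul, zero_sub, ← neg_mul] at h3
  refine h3.congr' ?_
  filter_upwards [hd, self_mem_nhdsWithin] with z hz hz0
  have : deriv h z = 2 * z * f z + z ^ 2 * f' z := by
    refine (hz.congr_of_eventuallyEq ?_).deriv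
    filter_upwards [isOpen_ne.mem_nhds hz0] with w hw
    exact Function.update_of_ne hw _ _
  rw [this]
  ring

/-- A pair of functions `f`, `g` with lattice of periods `L` that parametrizes the Weierstrass curve
`W` in the coordinates `x` and `v`, where `f` has a double pole at the lattice and `f' = 2 κ g`. For
`κ = 1` and `W` in short form these are the functions `℘` and `℘' / 2`. -/
structure IsWeierstrassPair (W : WeierstrassCurve ℂ) (L : AddSubgroup ℂ) (κ : ℂ) (f g : ℂ → ℂ) :
    Prop where
  lattice : IsPeriodLattice L
  even : IsEvenElliptic L f
  ne_zero : κ ≠ 0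
  hasDerivAt : ∀ z ∉ L, HasDerivAt f (2 * κ * g z) z
  sq_eq : ∀ z ∉ L, g z ^ 2 = cubic W (f z)
  tendsto : Tendsto (fun z ↦ z ^ 2 * f z) (𝓝[≠] 0) (𝓝 (κ ^ 2)⁻¹)

namespace IsWeierstrassPair

variable {W : WeierstrassCurve ℂ} {L : AddSubgroup ℂ} {κ : ℂ} {f g : ℂ → ℂ}

lemma tendsto_inv (h : IsWeierstrassPair W L κ f g) : Tendsto (fun z ↦ (f z)⁻¹) (𝓝[≠] 0) (𝓝 0) := by
  have h2 : Tendsto (fun z : ℂ ↦ z ^ 2) (𝓝[≠] 0) (𝓝 0) := by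
    simpa using (tendsto_id.mono_left (nhdsWithin_le_nhds (a := (0 : ℂ)) (s := {0}ᶜ))).pow 2
  have h3 := h2.div h.tendsto (inv_ne_zero (pow_ne_zero 2 h.ne_zero))
  rw [zero_div] at h3
  refine h3.congr' ?_
  filter_upwards [self_mem_nhdsWithin] with z hz
  have hz' : z ≠ 0 := hz
  simp only [Pi.div_apply]
  field_simp

lemma eventually_ne (h : IsWeierstrassPair W L κ f g) (a : ℂ) : ∀ᶠ z in 𝓝[≠] 0, f z ≠ a := by
  have h2 : Tendsto (fun z : ℂ ↦ z ^ 2 * a) (𝓝[≠] 0) (𝓝 0) := by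
    simpa using ((tendsto_id.mono_left
      (nhdsWithin_le_nhds (a := (0 : ℂ)) (s := {0}ᶜ))).pow 2).mul_const a
  have h3 := (h.tendsto.sub h2).eventually_ne (b₂ := (0 : ℂ)) (by simpa using h.ne_zero)
  filter_upwards [h3] with z hz hza
  simp [hza] at hz

lemma tendsto_g (h : IsWeierstrassPair W L κ f g) :
    Tendsto (fun z ↦ z ^ 3 * g z) (𝓝[≠] 0) (𝓝 (-(κ ^ 3)⁻¹)) := by
  have h1 := tendsto_cube_mul_deriv ((h.lattice.eventually_notMem 0).mono h.hasDerivAt) h.tendsto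
  have h2 := h1.const_mul (2 * κ)⁻¹
  have hκ := h.ne_zero
  have e : (2 * κ)⁻¹ * (-2 * (κ ^ 2)⁻¹) = -(κ ^ 3)⁻¹ := by field_simp
  rw [e] at h2
  refine h2.congr fun z ↦ ?_
  field_simp

lemma eventually_g_ne (h : IsWeierstrassPair W L κ f g) : ∀ᶠ z in 𝓝[≠] 0, g z ≠ 0 := by
  have h3 := h.tendsto_g.eventually_ne (b₂ := (0 : ℂ)) (by simpa using h.ne_zero)
  filter_upwards [h3] with z hz hza
  simp [hza] at hz

lemma g_add (h : IsWeierstrassPair W L κ f g) {z l : ℂ} (hz : z ∉ L) (hl : l ∈ L) :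
    g (z + l) = g z := by
  have h1 := h.hasDerivAt z hz
  have h2 : HasDerivAt f (2 * κ * g (z + l)) z := by
    have := (h.hasDerivAt (z + l) (by rwa [L.add_mem_cancel_right hl])).comp_add_const z l
    exact this.congr_of_eventuallyEq (Eventually.of_forall fun w ↦ (h.even.add_mem w l hl).symm)
  exact mul_left_cancel₀ (mul_ne_zero two_ne_zero h.ne_zero) (h2.unique h1)

lemma g_neg (h : IsWeierstrassPair W L κ f g) {z : ℂ} (hz : z ∉ L) : g (-z) = -g z := by
  have h1 := h.hasDerivAt z hz
  have h2 : HasDerivAt f (2 * κ * -g (-z)) z := by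
    have := (h.hasDerivAt (-z) (by rwa [neg_mem_iff])).comp z (hasDerivAt_neg z)
    refine (this.congr_of_eventuallyEq
      (Eventually.of_forall fun w ↦ (h.even.neg w).symm)).congr_deriv ?_
    ring
  have := mul_left_cancel₀ (mul_ne_zero two_ne_zero h.ne_zero) (h2.unique h1)
  rw [← this, neg_neg]

lemma differentiableAt_g (h : IsWeierstrassPair W L κ f g) {z : ℂ} (hz : z ∉ L) :
    DifferentiableAt ℂ g z := by
  have h1 : DifferentiableOn ℂ f (L : Set ℂ)ᶜ := fun w hw ↦
    (h.even.differentiableAt w hw).differentiableWithinAt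
  have h2 := ((h1.deriv h.lattice.isClosed.isOpen_compl).differentiableAt
    (h.lattice.isClosed.isOpen_compl.mem_nhds hz)).const_mul (2 * κ)⁻¹
  refine h2.congr_of_eventuallyEq ?_
  filter_upwards [h.lattice.eventually_notMem_nhds hz] with w hw
  rw [(h.hasDerivAt w hw).deriv]
  have := h.ne_zero
  field_simp

lemma hasDerivAt_cubic (h : IsWeierstrassPair W L κ f g) {z : ℂ} (hz : z ∉ L) :
    HasDerivAt (fun z ↦ cubic W (f z)) (cubicDeriv W (f z) * (2 * κ * g z)) z := by
  have h1 := h.hasDerivAt z hz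
  have h2 := (((h1.pow 3).add ((h1.pow 2).const_mul (W.b₂ / 4))).add
    (h1.const_mul (W.b₄ / 2))).add_const (W.b₆ / 4)
  refine h2.congr_deriv ?_
  simp only [cubicDeriv]
  push_cast
  ring

/-- The derivative of `g` is obtained by differentiating `g ^ 2 = cubic W f` close to `0`, where `g`
does not vanish, and by the identity theorem elsewhere. -/
lemma hasDerivAt_g (h : IsWeierstrassPair W L κ f g) {z : ℂ} (hz : z ∉ L) :
    HasDerivAt g (κ * cubicDeriv W (f z)) z := by
  have hd : DifferentiableOn ℂ (deriv g) (L : Set ℂ)ᶜ :=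
    DifferentiableOn.deriv (fun w hw ↦ (h.differentiableAt_g hw).differentiableWithinAt)
      h.lattice.isClosed.isOpen_compl
  have key : deriv g z - κ * cubicDeriv W (f z) = 0 := by
    refine eq_zero_of_eventually_eq_zero h.lattice.countable h.lattice.isClosed (a := 0)
      (F := fun z ↦ deriv g z - κ * cubicDeriv W (f z)) (fun w hw ↦ ?_)
      (h.lattice.eventually_notMem 0) ?_ hz
    · have h1 := h.even.differentiableAt w hw
      refine (hd.differentiableAt (h.lattice.isClosed.isOpen_compl.mem_nhds hw)).sub ?_
      simp only [cubicDeriv]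
      fun_prop
    · filter_upwards [h.lattice.eventually_notMem 0, h.eventually_g_ne] with w hw hgw
      have h1 := ((h.differentiableAt_g hw).hasDerivAt.pow 2)
      have h2 := (h.hasDerivAt_cubic hw).congr_of_eventuallyEq
        ((h.lattice.eventually_notMem_nhds hw).mono fun x hx ↦ h.sq_eq x hx)
      have h3 := h1.unique h2
      apply mul_left_cancel₀ (mul_ne_zero two_ne_zero hgw)
      push_cast at h3
      linear_combination h3
  rw [← sub_eq_zero.mp key]
  exact (h.differentiableAt_g hz).hasDerivAt

lemma eventually_ne_of_notMem (h : IsWeierstrassPair W L κ f g) {z : ℂ} (hz : z ∉ L) (a : ℂ) :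
    ∀ᶠ w in 𝓝[≠] z, f w ≠ a := by
  have han : AnalyticAt ℂ (fun w ↦ f w - a) z := by
    have : DifferentiableOn ℂ (fun w ↦ f w - a) (L : Set ℂ)ᶜ := fun w hw ↦
      ((h.even.differentiableAt w hw).sub_const a).differentiableWithinAt
    exact this.analyticAt (h.lattice.isClosed.isOpen_compl.mem_nhds hz)
  rcases han.eventually_eq_zero_or_eventually_ne_zero with h0 | h0
  · exfalso
    obtain ⟨w, hw, hwL⟩ := ((h.eventually_ne a).and (h.lattice.eventually_notMem 0)).exists
    refine hw (sub_eq_zero.mp (eq_zero_of_eventually_eq_zero h.lattice.countable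
      h.lattice.isClosed (a := z) (F := fun w ↦ f w - a) (fun w hw ↦
        (h.even.differentiableAt w hw).sub_const a) (h.lattice.eventually_notMem z)
        (h0.filter_mono nhdsWithin_le_nhds) hwL))
  · exact h0.mono fun w hw ↦ sub_ne_zero.mp hw

end IsWeierstrassPair

/-! ### The addition theorem -/

lemma hasDerivAt_addNumX (W : WeierstrassCurve ℂ) {x₁ v₁ x₂ v₂ : ℂ → ℂ} {x₁' v₁' x₂' v₂' t : ℂ}
    (hx₁ : HasDerivAt x₁ x₁' t) (hv₁ : HasDerivAt v₁ v₁' t) (hx₂ : HasDerivAt x₂ x₂' t)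
    (hv₂ : HasDerivAt v₂ v₂' t) :
    HasDerivAt (fun t ↦ addNumX W (x₁ t) (v₁ t) (x₂ t) (v₂ t))
      (2 * x₁ t * x₁' * x₂ t + x₁ t ^ 2 * x₂' + (x₁' * x₂ t ^ 2 + 2 * x₁ t * x₂ t * x₂') +
        W.b₂ / 2 * (x₁' * x₂ t + x₁ t * x₂') + W.b₄ / 2 * (x₁' + x₂') -
        2 * (v₁' * v₂ t + v₁ t * v₂')) t := by
  have h := ((((((hx₁.pow 2).mul hx₂).add (hx₁.mul (hx₂.pow 2))).add
    ((hx₁.mul hx₂).const_mul (W.b₂ / 2))).add ((hx₁.add hx₂).const_mul (W.b₄ / 2))).add_const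
    (W.b₆ / 2)).sub ((hv₁.const_mul 2).mul hv₂)
  refine h.congr_deriv ?_
  simp only [Pi.pow_apply]
  push_cast
  ring

namespace IsWeierstrassPair

variable {W : WeierstrassCurve ℂ} {L : AddSubgroup ℂ} {κ : ℂ} {f g : ℂ → ℂ}

/-- On the line `z + w = s` the right hand side of the addition formula has derivative zero, and it
tends to `f s` for `z → 0`; hence it is equal to `f s` close to `z = 0`. -/
lemma exists_eventually_addNumX_eq (h : IsWeierstrassPair W L κ f g) {s : ℂ} (hs : s ∉ L) :
    ∃ b, b ∉ L ∧ s - b ∉ L ∧ ∀ᶠ t in 𝓝 b,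
      addNumX W (f t) (g t) (f (s - t)) (g (s - t)) - f s * (f t - f (s - t)) ^ 2 = 0 := by
  have hsub : Tendsto (fun t : ℂ ↦ s - t) (𝓝[≠] 0) (𝓝 s) := by
    have : Tendsto (fun t : ℂ ↦ s - t) (𝓝 0) (𝓝 (s - 0)) := tendsto_const_nhds.sub tendsto_id
    rw [sub_zero] at this
    exact this.mono_left nhdsWithin_le_nhds
  have tf : Tendsto (fun t ↦ f (s - t)) (𝓝[≠] 0) (𝓝 (f s)) :=
    (h.even.differentiableAt s hs).continuousAt.tendsto.comp hsub
  have tg : Tendsto (fun t ↦ g (s - t)) (𝓝[≠] 0) (𝓝 (g s)) :=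
    (h.differentiableAt_g hs).continuousAt.tendsto.comp hsub
  have tp := h.tendsto_inv
  have tq : Tendsto (fun t ↦ g t * (f t)⁻¹ ^ 2) (𝓝[≠] 0) (𝓝 0) := by
    have h1 : Tendsto (fun z : ℂ ↦ z) (𝓝[≠] 0) (𝓝 0) := tendsto_id.mono_left nhdsWithin_le_nhds
    have h2 := (h1.mul h.tendsto_g).div (h.tendsto.pow 2)
      (pow_ne_zero 2 (inv_ne_zero (pow_ne_zero 2 h.ne_zero)))
    rw [zero_mul, zero_div] at h2
    refine h2.congr' ?_
    filter_upwards [self_mem_nhdsWithin] with z hz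
    have hz' : z ≠ 0 := hz
    simp only [Pi.div_apply]
    by_cases hf : f z = 0
    · simp [hf]
    · field_simp
  have ev : ∀ᶠ t in 𝓝[≠] (0 : ℂ), t ∉ L ∧ s - t ∉ L ∧ f t ≠ f (s - t) ∧ f t ≠ 0 := by
    have h1 : ∀ᶠ t in 𝓝[≠] (0 : ℂ), 1 - f (s - t) * (f t)⁻¹ ≠ 0 := by
      have := (tf.mul tp).const_sub 1
      exact this.eventually_ne (by simp)
    filter_upwards [h.lattice.eventually_notMem 0,
      hsub.eventually (h.lattice.eventually_notMem_nhds hs), h1, h.eventually_ne 0]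
      with t h1 h2 h3 h4
    refine ⟨h1, h2, fun h5 ↦ h3 ?_, h4⟩
    rw [← h5]
    field_simp
    simp
  set Φ : ℂ → ℂ := fun t ↦
    addNumX W (f t) (g t) (f (s - t)) (g (s - t)) / (f t - f (s - t)) ^ 2 with hΦ
  have hΦt : Tendsto Φ (𝓝[≠] 0) (𝓝 (f s)) := by
    have h1 := ((((((tf.add ((tf.pow 2).mul tp)).add ((tf.mul tp).const_mul (W.b₂ / 2))).add
      ((tp.add (tf.mul (tp.pow 2))).const_mul (W.b₄ / 2))).add
      ((tp.pow 2).const_mul (W.b₆ / 2))).sub ((tq.const_mul 2).mul tg)).div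
      (((tf.mul tp).const_sub 1).pow 2) (by simp))
    simp only [mul_zero, add_zero, zero_pow two_ne_zero, zero_mul, sub_zero, one_pow, div_one] at h1
    refine h1.congr' ?_
    filter_upwards [ev] with t ht
    obtain ⟨-, -, h3, h4⟩ := ht
    have h5 : f t - f (s - t) ≠ 0 := sub_ne_zero.mpr h3
    simp only [hΦ, addNumX, Pi.div_apply]
    have h6 : 1 - f (s - t) * (f t)⁻¹ = (f t - f (s - t)) / f t := by field_simp
    rw [h6]
    field_simp
  rw [eventually_nhdsWithin_iff, Metric.eventually_nhds_iff_ball] at ev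
  obtain ⟨r, hr, hB⟩ := ev
  -- The half disc is convex, unlike the punctured disc.
  set B : Set ℂ := Metric.ball 0 r ∩ {z | 0 < z.re} with hBdef
  have hBo : IsOpen B := Metric.isOpen_ball.inter (isOpen_lt continuous_const Complex.continuous_re)
  have hBc : Convex ℝ B := (convex_ball 0 r).inter (convex_halfSpace_re_gt 0)
  have hB' : ∀ t ∈ B, t ∉ L ∧ s - t ∉ L ∧ f t ≠ f (s - t) ∧ f t ≠ 0 := by
    intro t ht
    refine hB t ht.1 ?_
    rintro rfl
    simpa using ht.2
  have hderiv : ∀ t ∈ B, HasDerivAt Φ 0 t := by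
    intro t ht
    obtain ⟨h1, h2, h3, -⟩ := hB' t ht
    have d1 := h.hasDerivAt t h1
    have d2 := h.hasDerivAt_g h1
    have d3 := (h.hasDerivAt _ h2).comp_const_sub s t
    have d4 := (h.hasDerivAt_g h2).comp_const_sub s t
    have hd : f t - f (s - t) ≠ 0 := sub_ne_zero.mpr h3
    refine ((hasDerivAt_addNumX W d1 d2 d3 d4).div ((d1.sub d3).pow 2)
      (pow_ne_zero 2 hd)).congr_deriv ?_
    have e1 := h.sq_eq t h1
    have e2 := h.sq_eq _ h2
    simp only [cubic] at e1 e2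
    refine div_eq_zero_iff.mpr (Or.inl ?_)
    simp only [addNumX, cubicDeriv, Pi.sub_apply, Pi.pow_apply]
    push_cast
    linear_combination (f t - f (s - t)) * κ * (8 * g (s - t) * e1 + 8 * g t * e2)
  have hnear : Tendsto (fun x : ℝ ↦ (x : ℂ)) (𝓝[>] 0) (𝓝[≠] 0) := by
    refine tendsto_nhdsWithin_iff.mpr ⟨?_, ?_⟩
    · have : Tendsto (fun x : ℝ ↦ (x : ℂ)) (𝓝 0) (𝓝 ((0 : ℝ) : ℂ)) :=
        Complex.continuous_ofReal.tendsto 0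
      exact this.mono_left nhdsWithin_le_nhds
    · filter_upwards [self_mem_nhdsWithin] with x hx
      simpa using (ne_of_gt hx)
  have hBmem : ∀ᶠ x : ℝ in 𝓝[>] 0, (x : ℂ) ∈ B := by
    filter_upwards [self_mem_nhdsWithin, Ioo_mem_nhdsGT hr] with x hx hx'
    refine ⟨?_, by simpa using hx⟩
    simp only [Metric.mem_ball, dist_zero_right, Complex.norm_real, Real.norm_eq_abs]
    rw [abs_of_pos hx'.1]
    exact hx'.2
  obtain ⟨b, hb⟩ := hBmem.exists
  have hconst : ∀ t ∈ B, Φ t = Φ b := fun t ht ↦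
    hBo.is_const_of_deriv_eq_zero hBc.isPreconnected
      (fun t ht ↦ (hderiv t ht).differentiableAt.differentiableWithinAt)
      (fun t ht ↦ (hderiv t ht).deriv) ht hb
  have hlim : Φ b = f s := by
    have h1 : Tendsto (fun x : ℝ ↦ Φ x) (𝓝[>] 0) (𝓝 (f s)) := hΦt.comp hnear
    have h2 : Tendsto (fun x : ℝ ↦ Φ x) (𝓝[>] 0) (𝓝 (Φ b)) :=
      tendsto_const_nhds.congr' (hBmem.mono fun x hx ↦ (hconst x hx).symm)
    exact tendsto_nhds_unique h2 h1
  refine ⟨b, (hB' b hb).1, (hB' b hb).2.1, ?_⟩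
  filter_upwards [hBo.mem_nhds hb] with t ht
  have h1 := (hconst t ht).trans hlim
  have h2 : f t - f (s - t) ≠ 0 := sub_ne_zero.mpr (hB' t ht).2.2.1
  rw [sub_eq_zero, ← div_eq_iff (pow_ne_zero 2 h2)]
  exact h1

/-- The addition formula for `f`: with `s = z + w` fixed, both sides are holomorphic in `z` and
agree close to some point. -/
lemma add_mul_sq (h : IsWeierstrassPair W L κ f g) {z w : ℂ} (hz : z ∉ L) (hw : w ∉ L)
    (hzw : z + w ∉ L) : f (z + w) * (f z - f w) ^ 2 = addNumX W (f z) (g z) (f w) (g w) := by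
  obtain ⟨b, hb1, hb2, hb⟩ := h.exists_eventually_addNumX_eq hzw
  set s := z + w with hs
  have hinj : Function.Injective fun t : ℂ ↦ s - t := sub_right_injective
  have hcont : Continuous fun t : ℂ ↦ s - t := by fun_prop
  have hcount : ((L : Set ℂ) ∪ (fun t ↦ s - t) ⁻¹' L).Countable :=
    h.lattice.countable.union (h.lattice.countable.preimage hinj)
  have hclosed : IsClosed ((L : Set ℂ) ∪ (fun t ↦ s - t) ⁻¹' L) :=
    h.lattice.isClosed.union (h.lattice.isClosed.preimage hcont)
  have hmem : ∀ t, t ∉ (L : Set ℂ) ∪ (fun t ↦ s - t) ⁻¹' L ↔ t ∉ L ∧ s - t ∉ L := fun t ↦ by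
    simp
  have key := eq_zero_of_eventually_eq_zero hcount hclosed (a := b)
    (F := fun t ↦ addNumX W (f t) (g t) (f (s - t)) (g (s - t)) - f s * (f t - f (s - t)) ^ 2)
    (fun t ht ↦ ?_) ?_ (hb.filter_mono nhdsWithin_le_nhds) (z := z)
    ((hmem z).mpr ⟨hz, by simpa [hs] using hw⟩)
  · have e : s - z = w := by rw [hs]; ring
    rw [e] at key
    exact (sub_eq_zero.mp key).symm
  · obtain ⟨h1, h2⟩ := (hmem t).mp ht
    have d1 := h.hasDerivAt t h1
    have d3 := (h.hasDerivAt _ h2).comp_const_sub s t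
    exact (hasDerivAt_addNumX W d1 (h.hasDerivAt_g h1) d3
      ((h.hasDerivAt_g h2).comp_const_sub s t)).differentiableAt.sub
      (((d1.sub d3).pow 2).differentiableAt.const_mul _)
  · exact mem_nhdsWithin_of_mem_nhds (hclosed.isOpen_compl.mem_nhds ((hmem b).mpr ⟨hb1, hb2⟩))

/-- The addition formula for `g`, which is the derivative of the one for `f` with respect to `z`. -/
lemma add_mul_cube (h : IsWeierstrassPair W L κ f g) {z w : ℂ} (hz : z ∉ L) (hw : w ∉ L)
    (hzw : z + w ∉ L) : g (z + w) * (f z - f w) ^ 3 = addNumV W (f z) (g z) (f w) (g w) := by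
  have d1 := h.hasDerivAt z hz
  have d2 := h.hasDerivAt_g hz
  have hl := ((h.hasDerivAt _ hzw).comp_add_const z w).mul ((d1.sub_const (f w)).pow 2)
  have hr := hasDerivAt_addNumX W d1 d2 (hasDerivAt_const z (f w)) (hasDerivAt_const z (g w))
  have hev : ∀ᶠ t in 𝓝 z, f (t + w) * (f t - f w) ^ 2 = addNumX W (f t) (g t) (f w) (g w) := by
    have hc : Tendsto (fun t ↦ t + w) (𝓝 z) (𝓝 (z + w)) :=
      (continuous_add_const w).tendsto z
    filter_upwards [h.lattice.eventually_notMem_nhds hz,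
      hc.eventually (h.lattice.eventually_notMem_nhds hzw)] with t h1 h2
    exact h.add_mul_sq h1 hw h2
  have e := hl.unique (hr.congr_of_eventuallyEq hev)
  have e' := h.add_mul_sq hz hw hzw
  simp only [Pi.pow_apply] at e
  push_cast at e
  have hκ : 2 * κ ≠ 0 := mul_ne_zero two_ne_zero h.ne_zero
  apply mul_left_cancel₀ hκ
  simp only [addNumV]
  linear_combination (f z - f w) * e - 4 * κ * g z * e'

/-- A pair of functions that satisfies a Weierstrass equation defines a homomorphism to the group of
points of the curve. -/
theorem exists_addMonoidHom [W.IsElliptic] (h : IsWeierstrassPair W L κ f g) :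
    ∃ θ : ℂ →+ W.toAffine.Point, (∀ z, θ z = 0 ↔ z ∈ L) ∧
      ∀ z ∉ L, xCoord (θ z) = f z ∧ vCoord (θ z) = g z := by
  classical
  choose! P hP0 hPx hPv using fun z (hz : z ∉ L) ↦ exists_point (h.sq_eq z hz)
  let θ : ℂ → W.toAffine.Point := fun z ↦ if z ∈ L then 0 else P z
  have hθ0 : ∀ z ∈ L, θ z = 0 := fun z hz ↦ if_pos hz
  have hθ : ∀ z ∉ L, θ z ≠ 0 ∧ xCoord (θ z) = f z ∧ vCoord (θ z) = g z := fun z hz ↦ by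
    simp only [θ, if_neg hz]
    exact ⟨hP0 z hz, hPx z hz, hPv z hz⟩
  have hper : ∀ z, ∀ l ∈ L, θ (z + l) = θ z := by
    intro z l hl
    by_cases hz : z ∈ L
    · rw [hθ0 z hz, hθ0 _ (L.add_mem hz hl)]
    · have hz' : z + l ∉ L := by rwa [L.add_mem_cancel_right hl]
      refine point_ext (hθ _ hz').1 (hθ _ hz).1 ?_ ?_
      · rw [(hθ _ hz').2.1, (hθ _ hz).2.1, h.even.add_mem z l hl]
      · rw [(hθ _ hz').2.2, (hθ _ hz).2.2, h.g_add hz hl]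
  have hneg : ∀ z, θ (-z) = -θ z := by
    intro z
    by_cases hz : z ∈ L
    · rw [hθ0 z hz, hθ0 _ (L.neg_mem hz), neg_zero]
    · have hz' : -z ∉ L := by rwa [neg_mem_iff]
      refine point_ext (hθ _ hz').1 (neg_ne_zero.mpr (hθ _ hz).1) ?_ ?_
      · rw [xCoord_neg, (hθ _ hz').2.1, (hθ _ hz).2.1, h.even.neg]
      · rw [vCoord_neg, (hθ _ hz').2.2, (hθ _ hz).2.2, h.g_neg hz]
  have hgen : ∀ z w, z ∉ L → w ∉ L → z + w ∉ L → f z ≠ f w → θ (z + w) = θ z + θ w := by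
    intro z w hz hw hzw hne
    obtain ⟨hz0, hzx, hzv⟩ := hθ z hz
    obtain ⟨hw0, hwx, hwv⟩ := hθ w hw
    obtain ⟨hs0, hsx, hsv⟩ := hθ _ hzw
    obtain ⟨ha0, hax, hav⟩ := add_formula hz0 hw0 (by rwa [hzx, hwx])
    have hd : f z - f w ≠ 0 := sub_ne_zero.mpr hne
    rw [hzx, hwx, hzv, hwv] at hax hav
    refine point_ext hs0 ha0 ?_ ?_
    · rw [hsx]
      exact mul_right_cancel₀ (pow_ne_zero 2 hd) ((h.add_mul_sq hz hw hzw).trans hax.symm)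
    · rw [hsv]
      exact mul_right_cancel₀ (pow_ne_zero 3 hd) ((h.add_mul_cube hz hw hzw).trans hav.symm)
  have hadd : ∀ z w, θ (z + w) = θ z + θ w := by
    intro z w
    by_cases hz : z ∈ L
    · rw [hθ0 z hz, zero_add, add_comm, hper w z hz]
    by_cases hw : w ∈ L
    · rw [hθ0 w hw, add_zero, hper z w hw]
    by_cases hzw : z + w ∈ L
    · have : w = -z + (z + w) := by ring
      rw [hθ0 _ hzw, this, hper _ _ hzw, hneg, add_neg_cancel]
    by_cases hne : f z = f w
    swap
    · exact hgen z w hz hw hzw hne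
    -- Write `z + w = (z + t) + (w - t)` with `t` close to `-z`, so that all sums are generic.
    have hz' : -z ∉ L := by rwa [neg_mem_iff]
    have h1 : Tendsto (fun t ↦ z + t) (𝓝[≠] (-z)) (𝓝[≠] 0) := by
      refine tendsto_nhdsWithin_iff.mpr ⟨?_, ?_⟩
      · have : Tendsto (fun t ↦ z + t) (𝓝 (-z)) (𝓝 (z + -z)) :=
          (continuous_const_add z).tendsto (-z)
        rw [add_neg_cancel] at this
        exact this.mono_left nhdsWithin_le_nhds
      · filter_upwards [self_mem_nhdsWithin] with t ht h0
        exact ht (eq_neg_of_add_eq_zero_right h0)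
    have h2 : Tendsto (fun t ↦ w - t) (𝓝[≠] (-z)) (𝓝 (z + w)) := by
      have : Tendsto (fun t ↦ w - t) (𝓝 (-z)) (𝓝 (w - -z)) :=
        (continuous_const.sub continuous_id).tendsto (-z)
      rw [sub_neg_eq_add, add_comm] at this
      exact this.mono_left nhdsWithin_le_nhds
    have h3 : ∀ᶠ t in 𝓝[≠] (-z), 1 - f (w - t) * (f (z + t))⁻¹ ≠ 0 := by
      have := (((h.even.differentiableAt _ hzw).continuousAt.tendsto.comp h2).mul
        (h.tendsto_inv.comp h1)).const_sub 1
      exact this.eventually_ne (by simp)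
    obtain ⟨t, ht1, ht2, ht3, ht4, ht5, ht6⟩ := ((h1.eventually (h.lattice.eventually_notMem 0)).and
      ((h2.eventually (h.lattice.eventually_notMem_nhds hzw)).and (h3.and
      ((h.lattice.eventually_notMem (-z)).and ((h.eventually_ne_of_notMem hz' (f z)).and
      (h1.eventually (h.eventually_ne 0))))))).exists
    have ht3' : f (z + t) ≠ f (w - t) := by
      intro h5
      rw [← h5] at ht3
      field_simp at ht3
      simp at ht3
    have e : z + w = (z + t) + (w + -t) := by ring
    have hnt : -t ∉ L := by rwa [neg_mem_iff]
    rw [← sub_eq_add_neg] at e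
    rw [e, hgen _ _ ht1 ht2 (by rwa [← e]) ht3', hgen z t hz ht4 ht1 (Ne.symm ht5),
      sub_eq_add_neg, hgen w (-t) hw hnt (by rwa [← sub_eq_add_neg])
      (by rw [h.even.neg, ← hne]; exact Ne.symm ht5), hneg]
    abel
  refine ⟨⟨⟨θ, hθ0 0 L.zero_mem⟩, hadd⟩, fun z ↦ ⟨fun hz ↦ ?_, hθ0 z⟩, fun z hz ↦ (hθ z hz).2⟩
  by_contra hzL
  exact (hθ z hzL).1 hz

end IsWeierstrassPair

/-! ### Non-vanishing of the discriminant -/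

lemma exists_cubic_eq_of_Δ_eq_zero {W : WeierstrassCurve ℂ} (hΔ : W.Δ = 0) :
    ∃ r s : ℂ, ∀ x, cubic W x = (x - r) ^ 2 * (x - s) := by
  have ha : W.twoTorsionPolynomial.a ≠ 0 := by
    simp [twoTorsionPolynomial]
  obtain ⟨x, y, z, h3⟩ := (Cubic.splits_iff_roots_eq_three (φ := RingHom.id ℂ) ha).mp
    (IsAlgClosed.splits _)
  have hb := Cubic.b_eq_three_roots ha h3
  have hc := Cubic.c_eq_three_roots ha h3
  have hd := Cubic.d_eq_three_roots ha h3
  simp only [RingHom.id_apply, twoTorsionPolynomial] at hb hc hd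
  have hdisc : ¬W.twoTorsionPolynomial.discr ≠ 0 := by
    rw [twoTorsionPolynomial_discr, hΔ]
    simp
  rw [Cubic.discr_ne_zero_iff_roots_ne ha h3] at hdisc
  have key : ∀ t, cubic W t = (t - x) * (t - y) * (t - z) := by
    intro t
    simp only [cubic]
    linear_combination t ^ 2 / 4 * hb + t / 4 * hc + hd / 4
  by_cases hxy : x = y
  · exact ⟨x, z, fun t ↦ by rw [key, hxy]; ring⟩
  by_cases hxz : x = z
  · exact ⟨x, y, fun t ↦ by rw [key, hxz]; ring⟩
  by_cases hyz : y = z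
  · exact ⟨y, x, fun t ↦ by rw [key, hyz]; ring⟩
  exact absurd ⟨hxy, hxz, hyz⟩ hdisc

namespace IsWeierstrassPair

variable {W : WeierstrassCurve ℂ} {L : AddSubgroup ℂ} {κ : ℂ} {f g : ℂ → ℂ}

/-- A curve that is parametrized by doubly periodic functions is not singular. If the cubic had a
double root `r`, then `f` would not take the value `r`, by comparison of the orders of both sides of
`(f - r)' ^ 2 = 4 κ ^ 2 (f - r) ^ 2 (f - s)`, and `1 / (f - r)` would be constant. -/
theorem Δ_ne_zero (h : IsWeierstrassPair W L κ f g) : W.Δ ≠ 0 := by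
  intro hΔ
  obtain ⟨r, s, hrs⟩ := exists_cubic_eq_of_Δ_eq_zero hΔ
  have hne : ∀ z ∉ L, f z - r ≠ 0 := by
    intro z hz h0
    have hf : AnalyticAt ℂ f z := by
      have : DifferentiableOn ℂ f (L : Set ℂ)ᶜ := fun w hw ↦
        (h.even.differentiableAt w hw).differentiableWithinAt
      exact this.analyticAt (h.lattice.isClosed.isOpen_compl.mem_nhds hz)
    have hφ : AnalyticAt ℂ (fun w ↦ f w - r) z := hf.sub analyticAt_const
    have h1 : analyticOrderAt (deriv f) z + 1 = analyticOrderAt (fun w ↦ f w - r) z := by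
      rw [hf.analyticOrderAt_deriv_add_one, sub_eq_zero.mp h0]
    have htop : analyticOrderAt (fun w ↦ f w - r) z ≠ ⊤ := by
      intro h2
      rw [analyticOrderAt_eq_top] at h2
      obtain ⟨w, hw1, hw2⟩ := ((h.eventually_ne_of_notMem hz r).and
        (h2.filter_mono nhdsWithin_le_nhds)).exists
      exact hw1 (sub_eq_zero.mp hw2)
    have hB : AnalyticAt ℂ (fun w ↦ 4 * κ ^ 2 * (f w - s)) z :=
      analyticAt_const.mul (hf.sub analyticAt_const)
    have hev : (deriv f) ^ 2 =ᶠ[𝓝 z] (fun w ↦ f w - r) ^ 2 * fun w ↦ 4 * κ ^ 2 * (f w - s) := by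
      filter_upwards [h.lattice.eventually_notMem_nhds hz] with w hw
      have e := h.sq_eq w hw
      rw [hrs] at e
      simp only [Pi.pow_apply, Pi.mul_apply, (h.hasDerivAt w hw).deriv]
      linear_combination 4 * κ ^ 2 * e
    have h2 := analyticOrderAt_congr hev
    rw [analyticOrderAt_pow hf.deriv, analyticOrderAt_mul (hφ.pow 2) hB,
      analyticOrderAt_pow hφ, ← h1] at h2
    generalize hn : analyticOrderAt (deriv f) z = n at h1 h2
    have hn' : n ≠ ⊤ := by
      rintro rfl
      exact htop h1.symm
    have h3 : 2 • (n + 1) ≤ 2 • n := by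
      calc 2 • (n + 1) ≤ 2 • (n + 1) + analyticOrderAt (fun w ↦ 4 * κ ^ 2 * (f w - s)) z :=
            le_self_add
        _ = 2 • n := h2.symm
    lift n to ℕ using hn'
    rw [two_nsmul, two_nsmul] at h3
    norm_cast at h3
    omega
  have hinv : Tendsto (fun z ↦ (f z - r)⁻¹) (𝓝[≠] 0) (𝓝 0) := by
    have h1 : Tendsto (fun z ↦ 1 - r * (f z)⁻¹) (𝓝[≠] 0) (𝓝 1) := by
      simpa using (h.tendsto_inv.const_mul r).const_sub 1
    have h2 := h.tendsto_inv.div h1 one_ne_zero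
    rw [zero_div] at h2
    refine h2.congr' ?_
    filter_upwards [h.eventually_ne 0, h.lattice.eventually_notMem 0] with z hz hzL
    have h3 : 1 - r * (f z)⁻¹ = (f z - r) / f z := by field_simp
    have h4 := hne z hzL
    simp only [Pi.div_apply]
    rw [h3]
    field_simp
  obtain ⟨z, hz⟩ := (h.lattice.eventually_notMem 0).exists
  have := h.lattice.eq_of_tendsto
    (fun z hz ↦ ((h.even.differentiableAt z hz).sub_const r).inv (hne z hz))
    (fun z l hl ↦ by simp only [Pi.inv_apply, h.even.add_mem z l hl]) hinv hz
  exact hne z hz (inv_eq_zero.mp this)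

/-- The action of an admissible change of variables on Weierstrass pairs. -/
lemma of_variableChange (C : VariableChange ℂ) (h : IsWeierstrassPair (C • W) L κ f g) :
    IsWeierstrassPair W L (κ / C.u) (fun z ↦ C.u ^ 2 * f z + C.r) (fun z ↦ C.u ^ 3 * g z) where
  lattice := h.lattice
  even := ⟨fun z hz ↦ ((h.even.differentiableAt z hz).const_mul _).add_const _,
    fun z l hl ↦ by rw [h.even.add_mem z l hl], fun z ↦ by rw [h.even.neg z]⟩
  ne_zero := div_ne_zero h.ne_zero C.u.ne_zero
  hasDerivAt z hz := by
    refine (((h.hasDerivAt z hz).const_mul ((C.u : ℂ) ^ 2)).add_const C.r).congr_deriv ?_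
    have := C.u.ne_zero
    field_simp
  sq_eq z hz := by
    have e := h.sq_eq z hz
    have hu := C.u.ne_zero
    simp only [cubic, variableChange_b₂, variableChange_b₄, variableChange_b₆,
      Units.val_inv_eq_inv_val] at e ⊢
    rw [mul_pow, e]
    field_simp
    ring
  tendsto := by
    have hu := C.u.ne_zero
    have hκ := h.ne_zero
    have h2 : Tendsto (fun z : ℂ ↦ z ^ 2 * C.r) (𝓝[≠] 0) (𝓝 0) := by
      simpa using ((tendsto_id.mono_left
        (nhdsWithin_le_nhds (a := (0 : ℂ)) (s := {0}ᶜ))).pow 2).mul_const C.r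
    have h3 := (h.tendsto.const_mul ((C.u : ℂ) ^ 2)).add h2
    have e : (C.u : ℂ) ^ 2 * (κ ^ 2)⁻¹ + 0 = ((κ / C.u) ^ 2)⁻¹ := by
      field_simp
      simp
    rw [e] at h3
    refine h3.congr fun z ↦ ?_
    ring

end IsWeierstrassPair

/-! ### The coordinate functions of a uniformization -/

lemma isPeriodLattice_closure (τ : ℍ) :
    IsPeriodLattice (AddSubgroup.closure {1, (τ : ℂ)}) := by
  have him : (τ : ℂ).im ≠ 0 := τ.im_ne_zero
  let p : PeriodPair := ⟨1, τ, by
    rw [LinearIndependent.pair_iff]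
    intro s t hst
    have h1 := congrArg Complex.im hst
    have h2 := congrArg Complex.re hst
    simp at h1 h2
    have ht : t = 0 := by
      rcases h1 with h1 | h1
      · exact h1
      · exact absurd h1 him
    subst ht
    simpa using h2⟩
  have h : AddSubgroup.closure {1, (τ : ℂ)} = p.lattice.toAddSubgroup := by
    rw [← Submodule.span_int_eq_addSubgroupClosure]
    rfl
  refine ⟨?_, AddSubgroup.subset_closure (by simp), τ, AddSubgroup.subset_closure (by simp), him⟩
  rw [h]
  exact (inferInstance : DiscreteTopology p.lattice)

lemma tendsto_addNumX (W : WeierstrassCurve ℂ) {l : Filter ℂ} {x₁ v₁ : ℂ → ℂ} {a b : ℂ}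
    (hx : Tendsto x₁ l (𝓝 a)) (hv : Tendsto v₁ l (𝓝 b)) (x₂ v₂ : ℂ) :
    Tendsto (fun t ↦ addNumX W (x₁ t) (v₁ t) x₂ v₂) l (𝓝 (addNumX W a b x₂ v₂)) := by
  have hc : Continuous fun p : ℂ × ℂ ↦ addNumX W p.1 p.2 x₂ v₂ := by
    simp only [addNumX]
    fun_prop
  have h := (hc.tendsto (a, b)).comp (hx.prodMk_nhds hv)
  simpa only [Function.comp_def] using h

namespace IsUniformization

variable {W : WeierstrassCurve ℂ} {τ : ℍ} {π : ℂ →+ W.toAffine.Point}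

lemma isPeriodLattice (h : IsUniformization W τ π) : IsPeriodLattice π.ker := by
  rw [h.ker_eq]
  exact isPeriodLattice_closure τ

lemma differentiableAt_v (h : IsUniformization W τ π) {z : ℂ} (hz : π z ≠ 0) :
    DifferentiableAt ℂ (fun w ↦ vCoord (π w)) z := by
  have h1 := (h.differentiableAt_y z hz).add
    ((((h.differentiableAt_x z hz).const_mul W.a₁).add_const W.a₃).div_const 2)
  refine h1.congr_of_eventuallyEq ?_
  filter_upwards [h.isPeriodLattice.eventually_notMem_nhds (z := z) hz] with w hw
  exact vCoord_eq hw

lemma xCoord_ne {z w : ℂ} (hz : z ∉ π.ker) (hw : w ∉ π.ker) (h1 : z - w ∉ π.ker)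
    (h2 : z + w ∉ π.ker) : xCoord (π z) ≠ xCoord (π w) := by
  intro heq
  rcases eq_or_eq_neg_of_xCoord_eq hz hw heq with h3 | h3
  · exact h1 (by rw [AddMonoidHom.mem_ker, map_sub, h3, sub_self])
  · exact h2 (by rw [AddMonoidHom.mem_ker, map_add, h3, neg_add_cancel])

lemma exists_add_self_notMem (h : IsUniformization W τ π) :
    ∃ z₀, z₀ ∉ π.ker ∧ z₀ + z₀ ∉ π.ker ∧ vCoord (π z₀) ≠ 0 := by
  have hinj : Function.Injective fun z : ℂ ↦ z + z := fun a b hab ↦ by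
    have : (2 : ℂ) * a = 2 * b := by linear_combination hab
    exact mul_left_cancel₀ two_ne_zero this
  have hc : ((fun z : ℂ ↦ z + z) ⁻¹' π.ker).Countable :=
    h.isPeriodLattice.countable.preimage hinj
  obtain ⟨z, hz⟩ := (hc.dense_compl ℝ).nonempty
  have hz₀ : z + z ∉ π.ker := hz
  have hz₁ : z ∉ π.ker := fun hz ↦ hz₀ (add_mem hz hz)
  refine ⟨z, hz₁, hz₀, fun h0 ↦ hz₀ ?_⟩
  rw [AddMonoidHom.mem_ker, map_add]
  exact (vCoord_eq_zero_iff hz₁).mp h0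

/-- The quotient `x' / v` is constant. Indeed, the derivative of the addition formula with respect
to the first argument expresses the quotient at `w` by the quotient at a fixed point `z₀`, for generic
`w = z₀ + q`. -/
lemma exists_deriv_eq (h : IsUniformization W τ π) :
    ∃ κ ≠ 0, ∀ z ∉ π.ker, deriv (fun z ↦ xCoord (π z)) z = 2 * κ * vCoord (π z) := by
  have hL := h.isPeriodLattice
  set u : ℂ → ℂ := fun z ↦ xCoord (π z) with hu
  set v : ℂ → ℂ := fun z ↦ vCoord (π z) with hv
  have hmem : ∀ {z}, z ∉ π.ker ↔ π z ≠ 0 := fun {z} ↦ by rw [AddMonoidHom.mem_ker]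
  have du : ∀ z ∉ π.ker, DifferentiableAt ℂ u z := fun z hz ↦ h.differentiableAt_x z (hmem.mp hz)
  have dv : ∀ z ∉ π.ker, DifferentiableAt ℂ v z := fun z hz ↦ h.differentiableAt_v (hmem.mp hz)
  have hsq : ∀ z ∉ π.ker, v z ^ 2 = cubic W (u z) := fun z hz ↦ vCoord_sq (hmem.mp hz)
  obtain ⟨z₀, hz₁, hz₀, hv₀⟩ := h.exists_add_self_notMem
  change v z₀ ≠ 0 at hv₀
  set κ : ℂ := deriv u z₀ / (2 * v z₀) with hκ
  have hd₀ : deriv u z₀ = 2 * κ * v z₀ := by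
    rw [hκ]
    field_simp
  have hdv₀ : deriv v z₀ = κ * cubicDeriv W (u z₀) := by
    have h1 := (dv z₀ hz₁).hasDerivAt.pow 2
    have h2 := (du z₀ hz₁).hasDerivAt
    have h3 := (((h2.pow 3).add ((h2.pow 2).const_mul (W.b₂ / 4))).add
      (h2.const_mul (W.b₄ / 2))).add_const (W.b₆ / 4)
    have h4 := h1.unique (h3.congr_of_eventuallyEq
      ((hL.eventually_notMem_nhds hz₁).mono fun x hx ↦ hsq x hx))
    rw [hd₀] at h4
    apply mul_left_cancel₀ (mul_ne_zero two_ne_zero hv₀)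
    simp only [cubicDeriv]
    push_cast at h4
    linear_combination h4
  have hgen : ∀ w, w ∉ π.ker → w - z₀ ∉ π.ker → w - (z₀ + z₀) ∉ π.ker →
      deriv u w - 2 * κ * v w = 0 := by
    intro w hw h1 h2
    set q := w - z₀ with hq
    have hzq : z₀ + q = w := by rw [hq]; ring
    have hne : u z₀ ≠ u q := xCoord_ne hz₁ h1
      (fun h3 ↦ h2 (by
        have e : w - (z₀ + z₀) = -(z₀ - q) := by rw [hq]; ring
        rw [e]
        exact neg_mem h3)) (by rwa [hzq])
    have hform : ∀ t, t ∉ π.ker → u t ≠ u q →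
        u (t + q) * (u t - u q) ^ 2 = addNumX W (u t) (v t) (u q) (v q) ∧
        v (t + q) * (u t - u q) ^ 3 = addNumV W (u t) (v t) (u q) (v q) := by
      intro t ht hne
      have := add_formula (hmem.mp ht) (hmem.mp h1) hne
      rw [← map_add] at this
      exact this.2
    have d1 := (du z₀ hz₁).hasDerivAt
    have hl := ((du _ (by rwa [hzq])).hasDerivAt.comp_add_const z₀ q).mul
      ((d1.sub_const (u q)).pow 2)
    have hr := hasDerivAt_addNumX W d1 (dv z₀ hz₁).hasDerivAt (hasDerivAt_const z₀ (u q))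
      (hasDerivAt_const z₀ (v q))
    have hev : ∀ᶠ t in 𝓝 z₀, u (t + q) * (u t - u q) ^ 2 = addNumX W (u t) (v t) (u q) (v q) := by
      filter_upwards [hL.eventually_notMem_nhds hz₁, (du z₀ hz₁).continuousAt.eventually_ne hne]
        with t h3 h4
      exact (hform t h3 h4).1
    have e := hl.unique (hr.congr_of_eventuallyEq hev)
    obtain ⟨e1, e2⟩ := hform z₀ hz₁ hne
    simp only [Pi.pow_apply] at e
    rw [hd₀, hdv₀] at e
    push_cast at e
    rw [hzq] at e e1 e2
    have hdne : u z₀ - u q ≠ 0 := sub_ne_zero.mpr hne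
    apply mul_right_cancel₀ (pow_ne_zero 3 hdne)
    simp only [addNumV] at e2
    linear_combination (u z₀ - u q) * e - 4 * κ * v z₀ * e1 - 2 * κ * e2
  have hdu : ∀ z ∉ π.ker, deriv u z = 2 * κ * v z := by
    intro z hz
    have hdu' : DifferentiableOn ℂ (deriv u) (π.ker : Set ℂ)ᶜ :=
      DifferentiableOn.deriv (fun w hw ↦ (du w hw).differentiableWithinAt) hL.isClosed.isOpen_compl
    have hsh : ∀ a ∉ π.ker, ∀ᶠ w in 𝓝[≠] (0 : ℂ), w - a ∉ π.ker := by
      intro a ha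
      have h1 : Tendsto (fun w : ℂ ↦ w - a) (𝓝 0) (𝓝 (0 - a)) :=
        (continuous_id.sub continuous_const).tendsto 0
      have h2 : 0 - a ∉ π.ker := by rwa [zero_sub, neg_mem_iff]
      exact (h1.eventually (hL.eventually_notMem_nhds h2)).filter_mono nhdsWithin_le_nhds
    refine sub_eq_zero.mp (eq_zero_of_eventually_eq_zero hL.countable hL.isClosed (a := 0)
      (F := fun w ↦ deriv u w - 2 * κ * v w) (fun w hw ↦ ?_) (hL.eventually_notMem 0) ?_ hz)
    · exact (hdu'.differentiableAt (hL.isClosed.isOpen_compl.mem_nhds hw)).sub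
        ((dv w hw).const_mul _)
    · filter_upwards [hL.eventually_notMem 0, hsh _ hz₁, hsh _ hz₀] with w h1 h2 h3
      exact hgen w h1 h2 h3
  have hκ0 : κ ≠ 0 := by
    intro h0
    obtain ⟨z, hz, h1, h2⟩ : ∃ z, z ∉ π.ker ∧ z - z₀ ∉ π.ker ∧ z + z₀ ∉ π.ker := by
      have hc := hL.countable.union ((hL.countable.preimage
        (sub_left_injective (b := z₀))).union (hL.countable.preimage (add_left_injective z₀)))
      obtain ⟨z, hz⟩ := (hc.dense_compl ℝ).nonempty
      simp only [Set.mem_compl_iff, Set.mem_union, not_or, Set.mem_preimage, SetLike.mem_coe] at hz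
      exact ⟨z, hz⟩
    refine xCoord_ne hz hz₁ h1 h2 ?_
    exact hL.isClosed.isOpen_compl.is_const_of_deriv_eq_zero hL.isPreconnected_compl
      (fun w hw ↦ (du w hw).differentiableWithinAt)
      (fun w hw ↦ by rw [hdu w hw, h0]; simp) hz hz₁
  refine ⟨κ, hκ0, fun z hz ↦ ?_⟩
  simpa only using hdu z hz

/-- The function `x` has a double pole at the lattice, since `π z = π (z₀ + z) - π z₀`. -/
lemma tendsto_sq_mul_xCoord (h : IsUniformization W τ π) {κ : ℂ} (hκ0 : κ ≠ 0)
    (hdu : ∀ z ∉ π.ker, deriv (fun z ↦ xCoord (π z)) z = 2 * κ * vCoord (π z)) :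
    Tendsto (fun z ↦ z ^ 2 * xCoord (π z)) (𝓝[≠] 0) (𝓝 (κ ^ 2)⁻¹) := by
  have hL := h.isPeriodLattice
  set u : ℂ → ℂ := fun z ↦ xCoord (π z) with hu
  set v : ℂ → ℂ := fun z ↦ vCoord (π z) with hv
  have hmem : ∀ {z}, z ∉ π.ker ↔ π z ≠ 0 := fun {z} ↦ by rw [AddMonoidHom.mem_ker]
  obtain ⟨z₀, hz₁, hz₀, hv₀⟩ := h.exists_add_self_notMem
  change v z₀ ≠ 0 at hv₀
  have du : DifferentiableAt ℂ u z₀ := h.differentiableAt_x z₀ (hmem.mp hz₁)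
  have dv : DifferentiableAt ℂ v z₀ := h.differentiableAt_v (hmem.mp hz₁)
  have hd₀ : deriv u z₀ = 2 * κ * v z₀ := hdu z₀ hz₁
  have hsq : v z₀ ^ 2 = cubic W (u z₀) := vCoord_sq (hmem.mp hz₁)
  have hsh : ∀ a ∉ π.ker, ∀ᶠ w in 𝓝[≠] (0 : ℂ), a + w ∉ π.ker := by
    intro a ha
    have h1 : Tendsto (fun w : ℂ ↦ a + w) (𝓝 0) (𝓝 (a + 0)) := (continuous_const_add a).tendsto 0
    rw [add_zero] at h1
    exact (h1.eventually (hL.eventually_notMem_nhds ha)).filter_mono nhdsWithin_le_nhds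
  have ht : Tendsto (fun w : ℂ ↦ z₀ + w) (𝓝[≠] 0) (𝓝 z₀) := by
    have h1 : Tendsto (fun w : ℂ ↦ z₀ + w) (𝓝 0) (𝓝 (z₀ + 0)) :=
      (continuous_const_add z₀).tendsto 0
    rw [add_zero] at h1
    exact h1.mono_left nhdsWithin_le_nhds
  have tu : Tendsto (fun w ↦ u (z₀ + w)) (𝓝[≠] 0) (𝓝 (u z₀)) := du.continuousAt.tendsto.comp ht
  have tv : Tendsto (fun w ↦ v (z₀ + w)) (𝓝[≠] 0) (𝓝 (v z₀)) := dv.continuousAt.tendsto.comp ht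
  have hslope := hasDerivAt_iff_tendsto_slope_zero.mp du.hasDerivAt
  have tN : Tendsto (fun w ↦ addNumX W (u (z₀ + w)) (v (z₀ + w)) (u z₀) (-v z₀)) (𝓝[≠] 0)
      (𝓝 (addNumX W (u z₀) (v z₀) (u z₀) (-v z₀))) := tendsto_addNumX W tu tv _ _
  have e0 : addNumX W (u z₀) (v z₀) (u z₀) (-v z₀) = 4 * v z₀ ^ 2 := by
    have := hsq
    simp only [cubic] at this
    simp only [addNumX]
    linear_combination (-2) * this
  have h3 := tN.div (hslope.pow 2) (by
    rw [hd₀]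
    exact pow_ne_zero 2 (mul_ne_zero (mul_ne_zero two_ne_zero hκ0) hv₀))
  rw [e0, hd₀, show 4 * v z₀ ^ 2 / (2 * κ * v z₀) ^ 2 = (κ ^ 2)⁻¹ by field_simp; ring] at h3
  refine h3.congr' ?_
  filter_upwards [hL.eventually_notMem 0, hsh _ hz₁, hsh _ hz₀, self_mem_nhdsWithin]
    with w h4 h5 h6 h7
  have h7' : w ≠ 0 := h7
  have hne : u (z₀ + w) ≠ u z₀ := xCoord_ne h5 hz₁ (by rwa [add_sub_cancel_left])
    (by rwa [add_right_comm])
  have hf := (add_formula (hmem.mp h5) (neg_ne_zero.mpr (hmem.mp hz₁))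
    (by rwa [xCoord_neg])).2.1
  rw [xCoord_neg, vCoord_neg, map_add, add_neg_cancel_comm, ← map_add] at hf
  change u w * (u (z₀ + w) - u z₀) ^ 2 = addNumX W (u (z₀ + w)) (v (z₀ + w)) (u z₀) (-v z₀) at hf
  simp only [Pi.div_apply]
  rw [← hf]
  have hdne : u (z₀ + w) - u z₀ ≠ 0 := sub_ne_zero.mpr hne
  simp only [smul_eq_mul]
  field_simp
  rfl

/-- The functions `x` and `v` on the source of a uniformization form a Weierstrass pair. -/
theorem exists_isWeierstrassPair (h : IsUniformization W τ π) :
    ∃ κ, IsWeierstrassPair W π.ker κ (fun z ↦ xCoord (π z)) (fun z ↦ vCoord (π z)) := by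
  obtain ⟨κ, hκ0, hdu⟩ := h.exists_deriv_eq
  refine ⟨κ, h.isPeriodLattice, ⟨fun z hz ↦ h.differentiableAt_x z hz, fun z l hl ↦ ?_,
    fun z ↦ ?_⟩, hκ0, fun z hz ↦ hdu z hz ▸ (h.differentiableAt_x z hz).hasDerivAt,
    fun z hz ↦ vCoord_sq hz, h.tendsto_sq_mul_xCoord hκ0 hdu⟩
  · simp only [map_add, AddMonoidHom.mem_ker.mp hl, add_zero]
  · simp only [map_neg, xCoord_neg]

end IsUniformization

/-! ### Quotients by finite subgroups -/

section Quotient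

variable {W : WeierstrassCurve ℂ} (G : AddSubgroup W.toAffine.Point) [Fintype G]

open Classical in
/-- The non-zero elements of a finite subgroup. -/
def nonzeroPoints : Finset G := Finset.univ.filter (· ≠ 0)

/-- The numerator of `(x (P + Q) + x (P - Q)) / 2` over the denominator `(x P - x Q) ^ 2`, as a
polynomial in `x P` for a point `Q` with `x Q = q`. -/
def translateNum (W : WeierstrassCurve ℂ) (q : ℂ) : ℂ[X] :=
  C q * X ^ 2 + C (q ^ 2 + W.b₂ / 2 * q + W.b₄ / 2) * X + C (W.b₄ / 2 * q + W.b₆ / 2)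

/-- The denominator of the `x`-coordinate of the isogeny with kernel `G`. -/
def isogDen : ℂ[X] := ∏ Q ∈ nonzeroPoints G, (X - C (xCoord (Q : W.toAffine.Point))) ^ 2

open Classical in
/-- The numerator of the `x`-coordinate `P ↦ ∑ Q ∈ G, x (P + Q)` of the isogeny with kernel `G`
(Vélu's formula). -/
def isogNum : ℂ[X] :=
  X * isogDen G + ∑ Q ∈ nonzeroPoints G, translateNum W (xCoord (Q : W.toAffine.Point)) *
    ∏ Q' ∈ (nonzeroPoints G).erase Q, (X - C (xCoord (Q' : W.toAffine.Point))) ^ 2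

variable {G}

lemma xCoord_ne_of_notMem {P : W.toAffine.Point} (hP : P ∉ G) {Q : G} (hQ : Q ∈ nonzeroPoints G) :
    xCoord P ≠ xCoord (Q : W.toAffine.Point) := by
  intro h
  have hP0 : P ≠ 0 := fun h0 ↦ hP (h0 ▸ G.zero_mem)
  have hQ0 : (Q : W.toAffine.Point) ≠ 0 := by
    simpa [nonzeroPoints] using hQ
  rcases eq_or_eq_neg_of_xCoord_eq hP0 hQ0 h with h1 | h1
  · exact hP (h1 ▸ Q.2)
  · exact hP (h1 ▸ G.neg_mem Q.2)

lemma eval_isogDen_ne_zero {P : W.toAffine.Point} (hP : P ∉ G) :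
    (isogDen G).eval (xCoord P) ≠ 0 := by
  rw [isogDen, eval_prod, Finset.prod_ne_zero_iff]
  intro Q hQ
  simpa [sub_eq_zero] using xCoord_ne_of_notMem hP hQ

/-- The sum of `x` over a coset of `G` is a rational function of `x`: the terms for `Q` and `-Q` are
taken together, which eliminates `v`. -/
lemma sum_xCoord_add_eq {P : W.toAffine.Point} (hP : P ∉ G) :
    ∑ Q : G, xCoord (P + Q.1) = (isogNum G).eval (xCoord P) / (isogDen G).eval (xCoord P) := by
  classical
  have hP0 : P ≠ 0 := fun h0 ↦ hP (h0 ▸ G.zero_mem)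
  have h1 : ∑ Q : G, xCoord (P + Q.1) = xCoord P + ∑ Q ∈ nonzeroPoints G, xCoord (P + Q.1) := by
    rw [← Finset.sum_filter_add_sum_filter_not Finset.univ (fun Q : G ↦ Q = 0)]
    congr 1
    rw [Finset.filter_eq']
    simp
  have h2 : ∑ Q ∈ nonzeroPoints G, xCoord (P + Q.1) = ∑ Q ∈ nonzeroPoints G, xCoord (P - Q.1) := by
    refine Finset.sum_nbij' (fun Q ↦ -Q) (fun Q ↦ -Q) ?_ ?_ ?_ ?_ ?_ <;>
      simp [nonzeroPoints]
  have h3 : ∀ Q ∈ nonzeroPoints G, (xCoord (P + Q.1) + xCoord (P - Q.1)) / 2 =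
      (translateNum W (xCoord (Q : W.toAffine.Point))).eval (xCoord P) /
        (xCoord P - xCoord (Q : W.toAffine.Point)) ^ 2 := by
    intro Q hQ
    have hQ0 : (Q : W.toAffine.Point) ≠ 0 := by
      simpa [nonzeroPoints] using hQ
    have hx := xCoord_ne_of_notMem hP hQ
    have e1 := (add_formula hP0 hQ0 hx).2.1
    have e2 := (add_formula hP0 (neg_ne_zero.mpr hQ0) (by rwa [xCoord_neg])).2.1
    rw [xCoord_neg, vCoord_neg, ← sub_eq_add_neg] at e2
    rw [eq_div_iff (pow_ne_zero 2 (sub_ne_zero.mpr hx))]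
    simp only [addNumX] at e1 e2
    simp only [translateNum, eval_add, eval_mul, eval_C, eval_pow, eval_X]
    linear_combination e1 / 2 + e2 / 2
  have h4 : ∑ Q ∈ nonzeroPoints G, xCoord (P + Q.1) =
      ∑ Q ∈ nonzeroPoints G, (translateNum W (xCoord (Q : W.toAffine.Point))).eval (xCoord P) /
        (xCoord P - xCoord (Q : W.toAffine.Point)) ^ 2 := by
    rw [← Finset.sum_congr rfl h3, ← Finset.sum_div, Finset.sum_add_distrib, ← h2]
    ring
  have hden := eval_isogDen_ne_zero hP
  rw [h1, h4, isogNum, eval_add, eval_mul, eval_X, add_div, mul_div_cancel_right₀ _ hden,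
    eval_finsetSum, Finset.sum_div]
  congr 1
  refine Finset.sum_congr rfl fun Q hQ ↦ ?_
  have hx := sub_ne_zero.mpr (xCoord_ne_of_notMem hP hQ)
  have h5 : isogDen G = (X - C (xCoord (Q : W.toAffine.Point))) ^ 2 *
      ∏ Q' ∈ (nonzeroPoints G).erase Q, (X - C (xCoord (Q' : W.toAffine.Point))) ^ 2 :=
    (Finset.mul_prod_erase _ _ hQ).symm
  rw [h5, eval_mul] at hden
  rw [h5, eval_mul, eval_mul, mul_div_mul_right _ _ (right_ne_zero_of_mul hden)]
  simp

/-- The derivative of `isogNum / isogDen`, multiplied by the square of the denominator. -/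
def isogDerivNum (G : AddSubgroup W.toAffine.Point) [Fintype G] : ℂ[X] :=
  derivative (isogNum G) * isogDen G - isogNum G * derivative (isogDen G)

end Quotient

namespace IsUniformization

variable {W : WeierstrassCurve ℂ} {τ : ℍ} {π : ℂ →+ W.toAffine.Point}

/-- The preimage of a finite subgroup is discrete, since a multiple of it lies in the lattice. -/
lemma isPeriodLattice_comap (h : IsUniformization W τ π) (G : AddSubgroup W.toAffine.Point)
    [Finite G] : IsPeriodLattice (G.comap π) := by
  have hL := h.isPeriodLattice
  have hle : π.ker ≤ G.comap π := fun z hz ↦ by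
    rw [AddSubgroup.mem_comap, AddMonoidHom.mem_ker.mp hz]
    exact G.zero_mem
  refine ⟨?_, hle hL.one_mem, ?_⟩
  · have hn : (Nat.card G : ℂ) ≠ 0 := by
      exact_mod_cast Nat.card_pos.ne'
    have hmem : ∀ z : G.comap π, (Nat.card G : ℂ) * z ∈ π.ker := by
      intro z
      have h1 : (Nat.card G : ℂ) * z = Nat.card G • (z : ℂ) := by simp
      rw [h1, AddMonoidHom.mem_ker, map_nsmul]
      have h2 := card_nsmul_eq_zero' (x := (⟨π z, z.2⟩ : G))
      exact congrArg Subtype.val h2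
    have := hL.discrete
    refine DiscreteTopology.of_continuous_injective
      (f := fun z : G.comap π ↦ (⟨(Nat.card G : ℂ) * z, hmem z⟩ : π.ker)) ?_ ?_
    · exact Continuous.subtype_mk (by fun_prop) _
    · intro a b hab
      have h3 := congrArg Subtype.val hab
      exact Subtype.ext (mul_left_cancel₀ hn h3)
  · obtain ⟨t, ht, him⟩ := hL.exists_im_ne_zero
    exact ⟨t, hle ht, him⟩

lemma isEvenElliptic_sum (h : IsUniformization W τ π) (G : AddSubgroup W.toAffine.Point)
    [Fintype G] :
    IsEvenElliptic (G.comap π) (fun z ↦ ∑ Q : G, xCoord (π z + Q.1)) := by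
  refine ⟨fun z hz ↦ ?_, fun z l hl ↦ ?_, fun z ↦ ?_⟩
  · refine DifferentiableAt.fun_sum fun Q _ ↦ ?_
    obtain ⟨q, hq⟩ := h.surjective Q
    have hne : π (z + q) ≠ 0 := by
      intro h0
      apply hz
      rw [map_add, hq] at h0
      rw [AddSubgroup.mem_comap, eq_neg_of_add_eq_zero_left h0]
      exact G.neg_mem Q.2
    have h1 : DifferentiableAt ℂ (fun w ↦ xCoord (π (w + q))) z :=
      DifferentiableAt.comp (f := fun w ↦ w + q) z (h.differentiableAt_x (z + q) hne) (by fun_prop)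
    simpa only [map_add, hq] using h1
  · refine Fintype.sum_equiv (Equiv.addLeft (⟨π l, hl⟩ : G)) _ _ fun Q ↦ ?_
    simp [add_assoc]
  · refine Fintype.sum_equiv (Equiv.neg G) _ _ fun Q ↦ ?_
    rw [map_neg, ← xCoord_neg]
    simp [add_comm]

lemma tendsto_sum (h : IsUniformization W τ π) (G : AddSubgroup W.toAffine.Point) [Fintype G]
    {κ : ℂ}
    (ht : Tendsto (fun z ↦ z ^ 2 * xCoord (π z)) (𝓝[≠] 0) (𝓝 (κ ^ 2)⁻¹)) :
    Tendsto (fun z ↦ z ^ 2 * ∑ Q : G, xCoord (π z + Q.1)) (𝓝[≠] 0) (𝓝 (κ ^ 2)⁻¹) := by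
  classical
  have h1 : Tendsto (fun z ↦ ∑ Q : G, z ^ 2 * xCoord (π z + Q.1)) (𝓝[≠] 0)
      (𝓝 (∑ Q : G, if Q = 0 then (κ ^ 2)⁻¹ else 0)) := by
    refine tendsto_finsetSum _ fun Q _ ↦ ?_
    by_cases hQ : Q = 0
    · simpa [hQ] using ht
    · rw [if_neg hQ]
      obtain ⟨q, hq⟩ := h.surjective Q
      have hne : π q ≠ 0 := by
        rw [hq]
        simpa using hQ
      have h2 : Tendsto (fun z : ℂ ↦ z + q) (𝓝[≠] 0) (𝓝 q) := by
        have := (continuous_add_const q).tendsto (0 : ℂ)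
        rw [zero_add] at this
        exact this.mono_left nhdsWithin_le_nhds
      have h3 := (h.differentiableAt_x q hne).continuousAt.tendsto.comp h2
      have h4 := ((tendsto_id.mono_left
        (nhdsWithin_le_nhds (a := (0 : ℂ)) (s := {0}ᶜ))).pow 2).mul h3
      simpa [Function.comp_def, map_add, hq] using h4
  simpa [Finset.mul_sum] using h1

/-- The function `∑ Q ∈ G, x (π z + Q.1)` and its normalized derivative satisfy a Weierstrass
equation: they parametrize the quotient of the curve by `G`. -/
theorem exists_isWeierstrassPair_sum (h : IsUniformization W τ π)
    (G : AddSubgroup W.toAffine.Point) [Fintype G] {κ : ℂ}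
    (hp : IsWeierstrassPair W π.ker κ (fun z ↦ xCoord (π z)) (fun z ↦ vCoord (π z))) :
    ∃ a₂ a₄ a₆ : ℂ, IsWeierstrassPair ⟨0, a₂, 0, a₄, a₆⟩ (G.comap π) κ
      (fun z ↦ ∑ Q : G, xCoord (π z + Q.1))
      (fun z ↦ (isogDerivNum G).eval (xCoord (π z)) / (isogDen G).eval (xCoord (π z)) ^ 2 *
        vCoord (π z)) := by
  have hL := h.isPeriodLattice_comap G
  set f : ℂ → ℂ := fun z ↦ ∑ Q : G, xCoord (π z + Q.1) with hf
  set g : ℂ → ℂ := fun z ↦ (isogDerivNum G).eval (xCoord (π z)) /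
    (isogDen G).eval (xCoord (π z)) ^ 2 * vCoord (π z) with hg
  have hfe : IsEvenElliptic (G.comap π) f := h.isEvenElliptic_sum G
  have hft := h.tendsto_sum G hp.tendsto
  have hκ := hp.ne_zero
  have hnot : ∀ {z}, z ∉ G.comap π → z ∉ π.ker := fun {z} hz h0 ↦ hz (by
    rw [AddSubgroup.mem_comap, AddMonoidHom.mem_ker.mp h0]
    exact G.zero_mem)
  have hd : ∀ z ∉ G.comap π, HasDerivAt f (2 * κ * g z) z := by
    intro z hz
    have hu := hp.hasDerivAt z (hnot hz)
    have hden := eval_isogDen_ne_zero (P := π z) hz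
    have hn := ((isogNum G).hasDerivAt (xCoord (π z))).comp z hu
    have hd := ((isogDen G).hasDerivAt (xCoord (π z))).comp z hu
    have h1 := hn.fun_div hd hden
    refine (h1.congr_of_eventuallyEq ?_).congr_deriv ?_
    · filter_upwards [hL.eventually_notMem_nhds hz] with w hw
      exact sum_xCoord_add_eq hw
    · simp only [hg, isogDerivNum, eval_sub, eval_mul, Function.comp_apply]
      ring
  have hge : IsEvenElliptic (G.comap π) (fun z ↦ ((2 * κ)⁻¹ * deriv f z) ^ 2) := by
    refine ⟨fun z hz ↦ ?_, fun z l hl ↦ ?_, fun z ↦ ?_⟩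
    · have h1 : DifferentiableOn ℂ f (G.comap π : Set ℂ)ᶜ := fun w hw ↦
        (hfe.differentiableAt w hw).differentiableWithinAt
      exact (((h1.deriv hL.isClosed.isOpen_compl).differentiableAt
        (hL.isClosed.isOpen_compl.mem_nhds hz)).const_mul _).pow 2
    · have h1 : (fun w ↦ f (w + l)) = f := funext fun w ↦ hfe.add_mem w l hl
      rw [← deriv_comp_add_const, h1]
    · have h1 : (fun w ↦ f (-w)) = f := funext fun w ↦ hfe.neg w
      have h2 := deriv_comp_neg f z
      rw [h1] at h2
      rw [h2]
      ring
  have hgt : Tendsto (fun z ↦ z ^ (2 * 3) * ((2 * κ)⁻¹ * deriv f z) ^ 2) (𝓝[≠] 0)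
      (𝓝 ((κ ^ 2)⁻¹ ^ 3)) := by
    have h1 := tendsto_cube_mul_deriv (f' := deriv f) ((hL.eventually_notMem 0).mono fun z hz ↦
      (hfe.differentiableAt z hz).hasDerivAt) hft
    have h2 := (h1.const_mul (2 * κ)⁻¹).pow 2
    have e : ((2 * κ)⁻¹ * (-2 * (κ ^ 2)⁻¹)) ^ 2 = (κ ^ 2)⁻¹ ^ 3 := by field_simp
    rw [e] at h2
    refine h2.congr fun z ↦ ?_
    ring
  obtain ⟨p, hp3, hpc, hpe⟩ := hfe.exists_polynomial hL
    (inv_ne_zero (pow_ne_zero 2 hκ)) hft 3 hge hgt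
  rw [div_self (pow_ne_zero 3 (inv_ne_zero (pow_ne_zero 2 hκ)))] at hpc
  refine ⟨p.coeff 2, p.coeff 1, p.coeff 0, hL, hfe, hκ, hd, fun z hz ↦ ?_, hft⟩
  have h1 := hpe z hz
  rw [(hd z hz).deriv, eval_eq_sum_range' (Nat.lt_succ_of_le hp3)] at h1
  simp only [Finset.sum_range_succ, Finset.sum_range_zero, hpc] at h1
  have h2 : (2 * κ)⁻¹ * (2 * κ * g z) = g z := by field_simp
  rw [h2] at h1
  rw [h1]
  simp only [cubic, WeierstrassCurve.b₂, WeierstrassCurve.b₄, WeierstrassCurve.b₆]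
  ring

end IsUniformization

/-! ### Homomorphisms between complex tori are linear -/

/-- A local homomorphism `ℂ → ℂ` with complex derivative `α` at `0` is multiplication by `α`. -/
lemma eq_mul_of_hasDerivAt_of_double {ℓ : ℂ → ℂ} {α : ℂ} (hd : HasDerivAt ℓ α 0) (h0 : ℓ 0 = 0)
    {r : ℝ} (hℓ : ∀ z, ‖z‖ < r → ℓ z = 2 * ℓ (z / 2)) {z : ℂ} (hz : ‖z‖ < r) : ℓ z = α * z := by
  by_cases hz0 : z = 0
  · simp [hz0, h0]
  have hpow : ∀ n : ℕ, ‖z / 2 ^ n‖ < r ∧ ℓ z = 2 ^ n * ℓ (z / 2 ^ n) := by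
    intro n
    induction n with
    | zero => simpa using hz
    | succ n ih =>
      have e : z / 2 ^ (n + 1) = z / 2 ^ n / 2 := by
        rw [pow_succ]
        field_simp
      constructor
      · rw [e, norm_div]
        refine lt_of_le_of_lt (div_le_self (norm_nonneg _) ?_) ih.1
        simp
      · rw [ih.2, hℓ _ ih.1, e]
        ring
  have ht : Tendsto (fun n : ℕ ↦ z / 2 ^ n) atTop (𝓝[≠] 0) := by
    refine tendsto_nhdsWithin_iff.mpr ⟨?_, Eventually.of_forall fun n ↦ by simpa using hz0⟩
    have h1 : Tendsto (fun n : ℕ ↦ z * (1 / 2 : ℂ) ^ n) atTop (𝓝 (z * 0)) :=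
      (tendsto_pow_atTop_nhds_zero_of_norm_lt_one (by norm_num)).const_mul z
    rw [mul_zero] at h1
    refine h1.congr fun n ↦ ?_
    rw [div_pow, one_pow]
    ring
  have h1 := (hasDerivAt_iff_tendsto_slope_zero.mp hd).comp ht
  have h2 : Tendsto (fun _ : ℕ ↦ ℓ z / z) atTop (𝓝 α) := by
    refine h1.congr fun n ↦ ?_
    simp only [Function.comp_apply, zero_add, h0, sub_zero, smul_eq_mul, inv_div]
    rw [(hpow n).2]
    ring
  rw [← tendsto_nhds_unique tendsto_const_nhds h2]
  field_simp

/-- Homomorphisms from `ℂ` are determined by their values close to `0`, by divisibility. -/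
lemma eq_mul_of_eq_near_zero {A : Type*} [AddCommGroup A] {π θ : ℂ →+ A} {α : ℂ} {r : ℝ}
    (hr : 0 < r) (h : ∀ z, ‖z‖ < r → θ z = π (α * z)) (z : ℂ) : θ z = π (α * z) := by
  obtain ⟨n, hn⟩ := exists_nat_gt (‖z‖ / r)
  have hn0 : (0 : ℝ) < n := lt_of_le_of_lt (div_nonneg (norm_nonneg _) hr.le) hn
  have hn1 : (n : ℂ) ≠ 0 := by
    have : (n : ℝ) ≠ 0 := hn0.ne'
    exact_mod_cast this
  have h1 : ‖z / n‖ < r := by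
    rw [norm_div, Complex.norm_natCast, div_lt_iff₀ hn0]
    rwa [div_lt_iff₀ hr, mul_comm] at hn
  have e1 : z = n • (z / n) := by
    rw [nsmul_eq_mul]
    field_simp
  have e2 : α * z = n • (α * (z / n)) := by
    rw [nsmul_eq_mul]
    field_simp
  rw [e2]
  nth_rewrite 1 [e1]
  rw [map_nsmul, map_nsmul, h _ h1]

namespace IsUniformization

variable {W : WeierstrassCurve ℂ} {τ : ℍ} {π : ℂ →+ W.toAffine.Point}

/-- A homomorphism to the points of the curve which is holomorphic somewhere locally lifts to `ℂ`
through the uniformization. -/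
lemma exists_local_lift (h : IsUniformization W τ π) {θ : ℂ →+ W.toAffine.Point} {z₀ : ℂ}
    (hx : DifferentiableAt ℂ (fun z ↦ xCoord (θ z)) z₀)
    (hv : ContinuousAt (fun z ↦ vCoord (θ z)) z₀) (hv₀ : vCoord (θ z₀) ≠ 0) :
    ∃ (α : ℂ) (ℓ : ℂ → ℂ), HasDerivAt ℓ α 0 ∧ ℓ 0 = 0 ∧ ∀ᶠ z in 𝓝 0, π (ℓ z) = θ z := by
  obtain ⟨κ, hp⟩ := h.exists_isWeierstrassPair
  have hθ0 : θ z₀ ≠ 0 := fun h0 ↦ hv₀ (by rw [h0, vCoord_zero])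
  obtain ⟨w₀, hw₀⟩ := h.surjective (θ z₀)
  have hw₁ : w₀ ∉ π.ker := by rwa [AddMonoidHom.mem_ker, hw₀]
  set u : ℂ → ℂ := fun z ↦ xCoord (π z) with hu
  have han : AnalyticAt ℂ u w₀ := by
    have : DifferentiableOn ℂ u (π.ker : Set ℂ)ᶜ := fun w hw ↦
      (h.differentiableAt_x w hw).differentiableWithinAt
    exact this.analyticAt (h.isPeriodLattice.isClosed.isOpen_compl.mem_nhds hw₁)
  have hs : HasStrictDerivAt u (2 * κ * vCoord (π w₀)) w₀ := by
    have := han.hasStrictDerivAt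
    rwa [(hp.hasDerivAt w₀ hw₁).deriv] at this
  have hne : 2 * κ * vCoord (π w₀) ≠ 0 :=
    mul_ne_zero (mul_ne_zero two_ne_zero hp.ne_zero) (by rwa [hw₀])
  set inv := hs.localInverse u _ w₀ hne with hinv
  have hux : u w₀ = xCoord (θ z₀) := by rw [hu]; simp only [hw₀]
  have hinv0 : inv (xCoord (θ z₀)) = w₀ := by
    rw [← hux]
    exact (hs.eventually_left_inverse hne).self_of_nhds
  have hinvd : HasDerivAt inv (2 * κ * vCoord (π w₀))⁻¹ (xCoord (θ z₀)) := by
    rw [← hux]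
    exact (hs.to_localInverse hne).hasDerivAt
  set w : ℂ → ℂ := fun z ↦ inv (xCoord (θ z)) with hw
  have hwd := hinvd.comp z₀ hx.hasDerivAt
  have hwt : Tendsto w (𝓝 z₀) (𝓝 w₀) := by
    have := hwd.continuousAt.tendsto
    simp only [Function.comp_apply, hinv0] at this
    exact this
  have hcv : ContinuousAt (fun z ↦ vCoord (π z)) w₀ :=
    (h.differentiableAt_v hw₁).continuousAt
  have hsum : ∀ᶠ z in 𝓝 z₀, vCoord (π (w z)) + vCoord (θ z) ≠ 0 := by
    have h1 : Tendsto (fun z ↦ vCoord (π (w z)) + vCoord (θ z)) (𝓝 z₀)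
        (𝓝 (vCoord (π w₀) + vCoord (θ z₀))) := (hcv.tendsto.comp hwt).add hv.tendsto
    refine h1.eventually_ne ?_
    rw [hw₀, ← two_mul]
    exact mul_ne_zero two_ne_zero hv₀
  have hri : ∀ᶠ z in 𝓝 z₀, u (w z) = xCoord (θ z) := by
    have h1 := hs.eventually_right_inverse hne
    rw [hux] at h1
    exact hx.continuousAt.eventually h1
  have hloc : ∀ᶠ z in 𝓝 z₀, π (w z) = θ z := by
    filter_upwards [hsum, hri, hv.eventually_ne hv₀,
      hwt.eventually (h.isPeriodLattice.eventually_notMem_nhds hw₁)] with z h1 h2 h3 h4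
    have h5 : θ z ≠ 0 := fun h0 ↦ h3 (by rw [h0, vCoord_zero])
    refine point_ext h4 h5 h2 ?_
    have e1 := vCoord_sq h4
    have e2 := vCoord_sq h5
    have h2' : xCoord (π (w z)) = xCoord (θ z) := h2
    rw [h2', ← e2] at e1
    apply mul_right_cancel₀ h1
    linear_combination e1
  refine ⟨(2 * κ * vCoord (π w₀))⁻¹ * deriv (fun z ↦ xCoord (θ z)) z₀, fun z ↦ w (z₀ + z) - w₀,
    ?_, ?_, ?_⟩
  · have h1 : HasDerivAt w ((2 * κ * vCoord (π w₀))⁻¹ * deriv (fun z ↦ xCoord (θ z)) z₀)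
      (z₀ + 0) := by rw [add_zero]; exact hwd
    exact (h1.comp_const_add z₀ 0).sub_const w₀
  · simp only [add_zero, hw, hinv0, sub_self]
  · have h1 : Tendsto (fun z ↦ z₀ + z) (𝓝 0) (𝓝 z₀) := by
      simpa using (continuous_const_add z₀).tendsto (0 : ℂ)
    filter_upwards [h1.eventually hloc] with z hz
    rw [map_sub, hz, hw₀, map_add, add_sub_cancel_left]

/-- A homomorphism from `ℂ` to the points of the curve which is holomorphic somewhere factors as
multiplication by a complex number and the uniformization. -/
theorem exists_eq_mul (h : IsUniformization W τ π) {θ : ℂ →+ W.toAffine.Point} {z₀ : ℂ}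
    (hx : DifferentiableAt ℂ (fun z ↦ xCoord (θ z)) z₀)
    (hv : ContinuousAt (fun z ↦ vCoord (θ z)) z₀) (hv₀ : vCoord (θ z₀) ≠ 0) :
    ∃ α : ℂ, ∀ z, θ z = π (α * z) := by
  obtain ⟨α, ℓ, hd, h0, hloc⟩ := h.exists_local_lift hx hv hv₀
  have hdisc : ∀ᶠ z in 𝓝 (0 : ℂ), z ∈ π.ker → z = 0 := by
    have := h.isPeriodLattice.eventually_notMem 0
    rw [eventually_nhdsWithin_iff] at this
    filter_upwards [this] with z hz hzL
    by_contra hne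
    exact hz hne hzL
  have hc : Tendsto (fun z ↦ ℓ z - 2 * ℓ (z / 2)) (𝓝 0) (𝓝 0) := by
    have h1 : Tendsto ℓ (𝓝 0) (𝓝 0) := by
      simpa [h0] using hd.continuousAt.tendsto
    have h2 : Tendsto (fun z : ℂ ↦ z / 2) (𝓝 0) (𝓝 0) := by
      simpa using (continuous_id.div_const (2 : ℂ)).tendsto 0
    simpa using h1.sub ((h1.comp h2).const_mul 2)
  have h2 : Tendsto (fun z : ℂ ↦ z / 2) (𝓝 0) (𝓝 0) := by
    simpa using (continuous_id.div_const (2 : ℂ)).tendsto 0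
  obtain ⟨r, hr, hball⟩ := Metric.eventually_nhds_iff_ball.mp
    ((hc.eventually hdisc).and (hloc.and (h2.eventually hloc)))
  have hb : ∀ z : ℂ, ‖z‖ < r → z ∈ Metric.ball (0 : ℂ) r := fun z hz ↦ by simpa using hz
  refine ⟨α, eq_mul_of_eq_near_zero hr fun z hz ↦ ?_⟩
  have hdouble : ∀ z, ‖z‖ < r → ℓ z = 2 * ℓ (z / 2) := by
    intro z hz
    obtain ⟨h3, h4, h5⟩ := hball z (hb z hz)
    refine sub_eq_zero.mp (h3 ?_)
    rw [AddMonoidHom.mem_ker, map_sub, two_mul, map_add, h4, h5, ← map_add, add_halves, sub_self]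
  rw [← eq_mul_of_hasDerivAt_of_double hd h0 hdouble hz]
  exact (hball z (hb z hz)).2.1.symm

lemma differentiableAt_aeval {k : Type*} [Field k] [Algebra k ℂ] (p : MvPolynomial (Fin 2) k)
    {x y : ℂ → ℂ} {z : ℂ} (hx : DifferentiableAt ℂ x z) (hy : DifferentiableAt ℂ y z) :
    DifferentiableAt ℂ (fun w ↦ MvPolynomial.aeval ![x w, y w] p) z := by
  induction p using MvPolynomial.induction_on with
  | C a => simp
  | add p q hp hq => simpa using! hp.add hq
  | mul_X p i hp =>
    fin_cases i
    · simpa using! hp.mul hx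
    · simpa using! hp.mul hy

/-- Every isogeny from the curve to itself is induced by multiplication by a complex number. -/
theorem exists_mul_of_isIsogeny (h : IsUniformization W τ π)
    {ψ : W.toAffine.Point →+ W.toAffine.Point} (hψ : IsIsogeny ℂ ψ) :
    ∃ α : ℂ, ∀ z, ψ (π z) = π (α * z) := by
  obtain ⟨a, b, r, s, hfin⟩ := hψ
  set S := {Q : W.toAffine.Point | ¬ (Q ≠ 0 ∧ ψ Q ≠ 0 ∧
      MvPolynomial.aeval ![xCoord Q, yCoord Q] b ≠ 0 ∧
      MvPolynomial.aeval ![xCoord Q, yCoord Q] s ≠ 0 ∧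
      xCoord (ψ Q) =
        MvPolynomial.aeval ![xCoord Q, yCoord Q] a / MvPolynomial.aeval ![xCoord Q, yCoord Q] b ∧
      yCoord (ψ Q) =
        MvPolynomial.aeval ![xCoord Q, yCoord Q] r /
          MvPolynomial.aeval ![xCoord Q, yCoord Q] s)} with hS
  have hL := h.isPeriodLattice
  have hfib : ∀ Q : W.toAffine.Point, ∃ q, π ⁻¹' {Q} = (fun z ↦ z - q) ⁻¹' π.ker := by
    intro Q
    obtain ⟨q, hq⟩ := h.surjective Q
    refine ⟨q, Set.ext fun z ↦ ?_⟩
    simp only [Set.mem_preimage, Set.mem_singleton_iff, SetLike.mem_coe, AddMonoidHom.mem_ker,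
      map_sub, hq, sub_eq_zero]
  have hclosed : IsClosed (π ⁻¹' S) := by
    rw [← Set.biUnion_preimage_singleton]
    refine hfin.isClosed_biUnion fun Q _ ↦ ?_
    obtain ⟨q, hq⟩ := hfib Q
    rw [hq]
    exact hL.isClosed.preimage (by fun_prop)
  have hcount : (π ⁻¹' S).Countable := by
    rw [← Set.biUnion_preimage_singleton]
    refine hfin.countable.biUnion fun Q _ ↦ ?_
    obtain ⟨q, hq⟩ := hfib Q
    rw [hq]
    exact hL.countable.preimage sub_left_injective
  have hinj : Function.Injective fun z : ℂ ↦ z + z := fun a b hab ↦ by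
    have : (2 : ℂ) * a = 2 * b := by linear_combination hab
    exact mul_left_cancel₀ two_ne_zero this
  -- The exceptional set is avoided at `z₀`, for the coordinates to be holomorphic there, and at
  -- `z₀ + z₀`, for `v` not to vanish on `ψ (π z₀)`.
  obtain ⟨z₀, hz₀⟩ := ((hcount.union (hcount.preimage hinj)).dense_compl ℝ).nonempty
  simp only [Set.mem_compl_iff, Set.mem_union, not_or] at hz₀
  obtain ⟨h1, h2⟩ := hz₀
  have h1' : π z₀ ∉ S := h1
  have h2' : π (z₀ + z₀) ∉ S := h2
  simp only [hS, Set.mem_ofPred_eq, not_not] at h1' h2'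
  have hx := h.differentiableAt_x z₀ h1'.1
  have hy := h.differentiableAt_y z₀ h1'.1
  have hev : ∀ᶠ z in 𝓝 z₀, π z ∉ S := hclosed.isOpen_compl.mem_nhds h1
  have hψx : DifferentiableAt ℂ (fun z ↦ xCoord (ψ (π z))) z₀ := by
    refine ((differentiableAt_aeval a hx hy).div (differentiableAt_aeval b hx hy)
      h1'.2.2.1).congr_of_eventuallyEq ?_
    filter_upwards [hev] with z hz
    simp only [hS, Set.mem_ofPred_eq, not_not] at hz
    exact hz.2.2.2.2.1
  have hψy : DifferentiableAt ℂ (fun z ↦ yCoord (ψ (π z))) z₀ := by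
    refine ((differentiableAt_aeval r hx hy).div (differentiableAt_aeval s hx hy)
      h1'.2.2.2.1).congr_of_eventuallyEq ?_
    filter_upwards [hev] with z hz
    simp only [hS, Set.mem_ofPred_eq, not_not] at hz
    exact hz.2.2.2.2.2
  have hψv : DifferentiableAt ℂ (fun z ↦ vCoord (ψ (π z))) z₀ := by
    refine (hψy.add (((hψx.const_mul W.a₁).add_const W.a₃).div_const 2)).congr_of_eventuallyEq ?_
    filter_upwards [hev] with z hz
    simp only [hS, Set.mem_ofPred_eq, not_not] at hz
    exact vCoord_eq hz.2.1
  refine h.exists_eq_mul (θ := ψ.comp π) (z₀ := z₀) hψx hψv.continuousAt fun h0 ↦ h2'.2.1 ?_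
  rw [map_add, map_add]
  exact (vCoord_eq_zero_iff h1'.2.1).mp h0

end IsUniformization

/-! ### Isogenies from finite subgroups and from complex multiplications -/

lemma aeval_pair_aeval {k : Type*} [Field k] [Algebra k ℂ] (x y : ℂ) (p : k[X]) :
    MvPolynomial.aeval ![x, y] (aeval (MvPolynomial.X 0 : MvPolynomial (Fin 2) k) p) =
      aeval x p := by
  rw [← aeval_algHom_apply]
  simp

/-- A homomorphism that is given in the coordinates `x` and `v` by `x' = n / d`, `v' = (q / d²) v`
outside a finite set is an isogeny. -/
lemma isIsogeny_of_formula {k : Type*} [Field k] [Algebra k ℂ] {W W' : WeierstrassCurve ℂ}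
    {ψ : W.toAffine.Point →+ W'.toAffine.Point} {b₁ b₃ b₁' b₃' : k}
    (h₁ : algebraMap k ℂ b₁ = W.a₁) (h₃ : algebraMap k ℂ b₃ = W.a₃)
    (h₁' : algebraMap k ℂ b₁' = W'.a₁) (h₃' : algebraMap k ℂ b₃' = W'.a₃)
    (S : Set W.toAffine.Point) (hS : S.Finite) (hS0 : 0 ∈ S) (n d q : k[X])
    (hψ : ∀ P ∉ S, ψ P ≠ 0 ∧ aeval (xCoord P) d ≠ 0 ∧
      xCoord (ψ P) = aeval (xCoord P) n / aeval (xCoord P) d ∧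
      vCoord (ψ P) = aeval (xCoord P) q / aeval (xCoord P) d ^ 2 * vCoord P) :
    IsIsogeny k ψ := by
  let T : k[X] → MvPolynomial (Fin 2) k := aeval (MvPolynomial.X 0 : MvPolynomial (Fin 2) k)
  refine ⟨T n, T d, T q * (2 * MvPolynomial.X 1 + MvPolynomial.C b₁ * MvPolynomial.X 0 +
    MvPolynomial.C b₃) - (MvPolynomial.C b₁' * T n * T d + MvPolynomial.C b₃' * T d ^ 2),
    2 * T d ^ 2, hS.subset ?_⟩
  intro P hP
  by_contra hPS
  apply hP
  obtain ⟨e0, ed, ex, ev⟩ := hψ P hPS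
  have hP0 : P ≠ 0 := fun h0 ↦ hPS (h0 ▸ hS0)
  have hT : ∀ p, MvPolynomial.aeval ![xCoord P, yCoord P] (T p) = aeval (xCoord P) p :=
    aeval_pair_aeval _ _
  refine ⟨hP0, e0, by rwa [hT], ?_, by rwa [hT, hT], ?_⟩
  · rw [map_mul, map_pow, hT]
    simpa using ed
  · rw [vCoord_eq hP0, vCoord_eq e0, ex] at ev
    have ey := eq_sub_of_add_eq ev
    rw [ey]
    simp only [map_sub, map_mul, map_add, map_pow, hT, MvPolynomial.aeval_X, MvPolynomial.aeval_C,
      h₁, h₃, h₁', h₃', map_ofNat, Matrix.cons_val_zero, Matrix.cons_val_one]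
    field_simp
    ring

namespace IsUniformization

variable {W : WeierstrassCurve ℂ} {τ : ℍ} {π : ℂ →+ W.toAffine.Point}

lemma finite_of_isPeriodLattice_comap (h : IsUniformization W τ π)
    {G : AddSubgroup W.toAffine.Point} (hG : IsPeriodLattice (G.comap π)) : Finite G := by
  obtain ⟨K, hK, hKL⟩ := h.isPeriodLattice.exists_isCompact
  have hc : IsCompact (K ∩ (G.comap π : Set ℂ)) := hK.inter_right hG.isClosed
  have hd : IsDiscrete (G.comap π : Set ℂ) := ⟨hG.discrete⟩
  have hfin := (hc.finite (hd.mono Set.inter_subset_right)).image π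
  refine (hfin.subset fun Q hQ ↦ ?_).to_subtype
  obtain ⟨z, rfl⟩ := h.surjective Q
  obtain ⟨w, hw, hzw⟩ := hKL z
  rw [AddMonoidHom.mem_ker, map_sub, sub_eq_zero] at hzw
  refine ⟨w, ⟨hw, ?_⟩, hzw.symm⟩
  change π w ∈ G
  rw [← hzw]
  exact hQ

/-- Multiplication by a non-zero complex number that preserves the lattice is an isogeny: the
functions `x (α z)` and `∑ Q, x (z + Q)`, with `Q` in the kernel, have the same periods and a double
pole there, so that one is an affine function of the other. -/
theorem isIsogeny_of_mul (h : IsUniformization W τ π) {α : ℂ} (hα : α ≠ 0)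
    (hαL : ∀ z ∈ π.ker, α * z ∈ π.ker) {ψ : W.toAffine.Point →+ W.toAffine.Point}
    (hψ : ∀ z, ψ (π z) = π (α * z)) : IsIsogeny ℂ ψ := by
  obtain ⟨κ, hp⟩ := h.exists_isWeierstrassPair
  have hmem : ∀ z, z ∈ ψ.ker.comap π ↔ α * z ∈ π.ker := fun z ↦ by
    rw [AddSubgroup.mem_comap, AddMonoidHom.mem_ker, AddMonoidHom.mem_ker, hψ]
  have hL : IsPeriodLattice (ψ.ker.comap π) := by
    have hL₀ := h.isPeriodLattice
    obtain ⟨t, ht, him⟩ := hL₀.exists_im_ne_zero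
    refine ⟨?_, (hmem 1).mpr (hαL 1 hL₀.one_mem), t, (hmem t).mpr (hαL t ht), him⟩
    have := hL₀.discrete
    refine DiscreteTopology.of_continuous_injective
      (f := fun z : ψ.ker.comap π ↦ (⟨α * z, (hmem z).mp z.2⟩ : π.ker)) ?_ ?_
    · exact Continuous.subtype_mk (by fun_prop) _
    · intro a b hab
      exact Subtype.ext (mul_left_cancel₀ hα (congrArg Subtype.val hab))
  have hfin := h.finite_of_isPeriodLattice_comap hL
  have := Fintype.ofFinite ψ.ker
  obtain ⟨a₂, a₄, a₆, hq⟩ := h.exists_isWeierstrassPair_sum ψ.ker hp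
  set f : ℂ → ℂ := fun z ↦ ∑ Q : ψ.ker, xCoord (π z + Q.1) with hf
  have hd : ∀ z ∉ ψ.ker.comap π, HasDerivAt (fun z ↦ xCoord (π (α * z)))
      (2 * κ * vCoord (π (α * z)) * α) z := by
    intro z hz
    have h1 := (hp.hasDerivAt (α * z) (mt (hmem z).mpr hz)).comp z (hasDerivAt_const_mul α)
    exact h1
  have hF : IsEvenElliptic (ψ.ker.comap π) (fun z ↦ xCoord (π (α * z))) := by
    refine ⟨fun z hz ↦ (hd z hz).differentiableAt, fun z l hl ↦ ?_, fun z ↦ ?_⟩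
    · rw [mul_add]
      exact hp.even.add_mem _ _ ((hmem l).mp hl)
    · rw [mul_neg]
      exact hp.even.neg _
  have hFt : Tendsto (fun z ↦ z ^ (2 * 1) * xCoord (π (α * z))) (𝓝[≠] 0)
      (𝓝 ((α ^ 2)⁻¹ * (κ ^ 2)⁻¹)) := by
    have h1 : Tendsto (fun z : ℂ ↦ α * z) (𝓝[≠] 0) (𝓝[≠] 0) := by
      refine tendsto_nhdsWithin_iff.mpr ⟨?_, ?_⟩
      · have : Tendsto (fun z : ℂ ↦ α * z) (𝓝 0) (𝓝 (α * 0)) :=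
          (continuous_const_mul α).tendsto 0
        rw [mul_zero] at this
        exact this.mono_left nhdsWithin_le_nhds
      · filter_upwards [self_mem_nhdsWithin] with z hz
        exact mul_ne_zero hα hz
    refine ((hp.tendsto.comp h1).const_mul (α ^ 2)⁻¹).congr fun z ↦ ?_
    simp only [Function.comp_apply]
    field_simp
    ring
  have hκ := hp.ne_zero
  obtain ⟨p, hp1, hpc, hpe⟩ := hq.even.exists_polynomial hL
    (inv_ne_zero (pow_ne_zero 2 hκ)) hq.tendsto 1 hF hFt
  set a : ℂ := p.coeff 1 with ha
  set b : ℂ := p.coeff 0 with hb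
  have hx : ∀ z ∉ ψ.ker.comap π, xCoord (π (α * z)) = a * f z + b := by
    intro z hz
    rw [hpe z hz, eval_eq_sum_range' (Nat.lt_succ_of_le hp1)]
    simp only [Finset.sum_range_succ, Finset.sum_range_zero]
    ring
  have hv : ∀ z ∉ ψ.ker.comap π, vCoord (π (α * z)) = a / α *
      ((isogDerivNum ψ.ker).eval (xCoord (π z)) / (isogDen ψ.ker).eval (xCoord (π z)) ^ 2 *
        vCoord (π z)) := by
    intro z hz
    have h1 := ((hq.hasDerivAt z hz).const_mul a).add_const b
    have h2 := h1.congr_of_eventuallyEq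
      ((hL.eventually_notMem_nhds hz).mono fun w hw ↦ hx w hw)
    have h3 := (hd z hz).unique h2
    have h4 : vCoord (π (α * z)) * (2 * κ * α) = (2 * κ * α) * vCoord (π (α * z)) := mul_comm _ _
    apply mul_left_cancel₀ (mul_ne_zero (mul_ne_zero two_ne_zero hκ) hα)
    rw [← h4]
    calc _ = 2 * κ * vCoord (π (α * z)) * α := by ring
      _ = _ := h3
      _ = _ := by field_simp
  refine isIsogeny_of_formula (k := ℂ) rfl rfl rfl rfl (ψ.ker : Set W.toAffine.Point)
    (Set.toFinite _) ψ.ker.zero_mem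
    (C a * isogNum ψ.ker + C b * isogDen ψ.ker) (isogDen ψ.ker)
    (C (a / α) * isogDerivNum ψ.ker) fun P hP ↦ ?_
  obtain ⟨z, rfl⟩ := h.surjective P
  have hden := eval_isogDen_ne_zero (G := ψ.ker) hP
  simp only [coe_aeval_eq_eval, eval_add, eval_mul, eval_C]
  refine ⟨hP, hden, ?_, ?_⟩
  · rw [hψ, hx z hP, hf]
    simp only
    rw [sum_xCoord_add_eq hP]
    field_simp
  · rw [hψ, hv z hP]
    ring

/-- The endomorphism of the group of points that corresponds to a multiplication by a complex number
that preserves the lattice. -/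
lemma exists_addMonoidHom_mul (h : IsUniformization W τ π) {α : ℂ}
    (hαL : ∀ z ∈ π.ker, α * z ∈ π.ker) :
    ∃ ψ : W.toAffine.Point →+ W.toAffine.Point, ∀ z, ψ (π z) = π (α * z) := by
  refine ⟨π.liftOfSurjective h.surjective ⟨π.comp (AddMonoidHom.mulLeft α), fun z hz ↦ ?_⟩,
    fun z ↦ ?_⟩
  · exact hαL z hz
  · exact AddMonoidHom.liftOfRightInverse_comp_apply _ _ _ _ z

end IsUniformization

/-! ### Descent from the complex numbers -/

open scoped IntermediateField.algebraAdjoinAdjoin in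
/-- An element of `Frac F[s]`, for `s` algebraically independent, that is algebraic over `F` lies
in `F`: it is integral over the integrally closed ring `F[s]`, and it is a unit there. -/
lemma _root_.AlgebraicIndependent.mem_range_of_isIntegral {F L : Type*} [Field F] [Field L]
    [Algebra F L] {s : Set L} (hs : AlgebraicIndependent F ((↑) : s → L)) {z : L}
    (hz : z ∈ IntermediateField.adjoin F s) (hzi : _root_.IsIntegral F z) :
    z ∈ (algebraMap F L).range := by
  rcases eq_or_ne z 0 with rfl | hz0
  · exact zero_mem _
  have key : ∀ w ∈ IntermediateField.adjoin F s, _root_.IsIntegral F w →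
      w ∈ Algebra.adjoin F s := by
    intro w hw hwi
    let e := hs.aevalEquiv
    rw [Subtype.range_coe] at e
    have : IsIntegrallyClosed (Algebra.adjoin F s) := IsIntegrallyClosed.of_equiv e.toRingEquiv
    have h1 : _root_.IsIntegral (Algebra.adjoin F s) (⟨w, hw⟩ : IntermediateField.adjoin F s) := by
      have h2 : _root_.IsIntegral F (⟨w, hw⟩ : IntermediateField.adjoin F s) :=
        (isIntegral_algebraMap_iff (algebraMap (IntermediateField.adjoin F s) L).injective).mp hwi
      exact h2.tower_top
    obtain ⟨y, hy⟩ := IsIntegrallyClosed.isIntegral_iff.mp h1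
    have := congrArg Subtype.val hy
    rw [← show (y : L) = w from this]
    exact y.2
  have h1 := key z hz hzi
  have h2 := key z⁻¹ (inv_mem hz) hzi.inv
  obtain ⟨p, hp⟩ : ∃ p : MvPolynomial s F, MvPolynomial.aeval ((↑) : s → L) p = z := by
    rwa [← Subtype.range_coe (s := s), Algebra.adjoin_range_eq_range_aeval] at h1
  obtain ⟨q, hq⟩ : ∃ p : MvPolynomial s F, MvPolynomial.aeval ((↑) : s → L) p = z⁻¹ := by
    rwa [← Subtype.range_coe (s := s), Algebra.adjoin_range_eq_range_aeval] at h2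
  have hpq : p * q = 1 := by
    apply hs
    rw [map_mul, hp, hq, map_one, mul_inv_cancel₀ hz0]
  obtain ⟨a, -, ha⟩ := MvPolynomial.isUnit_iff_eq_C_of_isReduced.mp (IsUnit.of_mul_eq_one q hpq)
  exact ⟨a, by rw [← hp, ha, MvPolynomial.aeval_C]⟩

/-- An algebraic element that is fixed by all automorphisms of an algebraically closed field over
`F` lies in `F`. For a transcendence basis `s`, the field is Galois over `F(s)`, so that such an
element lies in `F(s)`. -/
lemma mem_range_of_isIntegral_of_fixed {F L : Type*} [Field F] [CharZero F] [Field L]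
    [IsAlgClosed L] [Algebra F L] {z : L} (hzi : _root_.IsIntegral F z)
    (hz : ∀ σ : L ≃ₐ[F] L, σ z = z) : z ∈ (algebraMap F L).range := by
  obtain ⟨s, hs⟩ := exists_isTranscendenceBasis F L
  refine hs.1.mem_range_of_isIntegral ?_ hzi
  have halg : Algebra.IsAlgebraic (IntermediateField.adjoin F s) L := by
    have := hs.isAlgebraic_field
    rwa [Subtype.range_coe] at this
  have : IsAlgClosure (IntermediateField.adjoin F s) L := ⟨inferInstance, halg⟩
  have : Normal (IntermediateField.adjoin F s) L := IsAlgClosure.normal _ _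
  have : CharZero (IntermediateField.adjoin F s) :=
    charZero_of_injective_algebraMap (algebraMap F (IntermediateField.adjoin F s)).injective
  have : IsGalois (IntermediateField.adjoin F s) L := {}
  obtain ⟨y, hy⟩ := (InfiniteGalois.mem_range_algebraMap_iff_fixed
    (k := IntermediateField.adjoin F s) z).mpr fun σ ↦ hz (σ.restrictScalars F)
  rw [← hy]
  exact y.2

/-- The fixed field of the group of all automorphisms of an algebraically closed field over `F` is
`F`. A transcendental `z` cannot be fixed, since it does not lie in `F(z²)`. -/
theorem mem_range_of_fixed {F L : Type*} [Field F] [CharZero F] [Field L]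
    [IsAlgClosed L] [Algebra F L] {z : L} (hz : ∀ σ : L ≃ₐ[F] L, σ z = z) :
    z ∈ (algebraMap F L).range := by
  by_cases hzi : _root_.IsIntegral F z
  · exact mem_range_of_isIntegral_of_fixed hzi hz
  exfalso
  let M := IntermediateField.adjoin F {z ^ 2}
  have : CharZero M := charZero_of_injective_algebraMap (algebraMap F M).injective
  have hi : _root_.IsIntegral M z := by
    refine IsIntegral.of_pow two_pos ?_
    exact isIntegral_algebraMap (x := (⟨z ^ 2, IntermediateField.mem_adjoin_simple_self F _⟩ : M))
  obtain ⟨y, hy⟩ := mem_range_of_isIntegral_of_fixed hi fun σ ↦ hz (σ.restrictScalars F)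
  have hzM : z ∈ M := by
    rw [← hy]
    exact y.2
  obtain ⟨p, q, hpq⟩ := (IntermediateField.mem_adjoin_simple_iff F z).mp hzM
  have hz0 : z ≠ 0 := by
    rintro rfl
    exact hzi isIntegral_zero
  have hq : aeval (z ^ 2) q ≠ 0 := by
    intro h0
    rw [h0, div_zero] at hpq
    exact hz0 hpq
  have hq0 : q ≠ 0 := by
    rintro rfl
    exact hq (map_zero _)
  have h1 : aeval z (X * expand F 2 q - expand F 2 p) = 0 := by
    rw [map_sub, map_mul, aeval_X, expand_aeval, expand_aeval, sub_eq_zero]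
    exact (eq_div_iff hq).mp hpq
  have h2 : X * expand F 2 q - expand F 2 p = 0 := by
    by_contra hne
    exact hzi (isAlgebraic_iff_isIntegral.mp ⟨_, hne, h1⟩)
  -- The degree of `X * q(X²)` is odd and that of `p(X²)` is even.
  have h3 := congrArg natDegree (sub_eq_zero.mp h2)
  rw [natDegree_X_mul ((expand_ne_zero two_pos).mpr hq0), natDegree_expand, natDegree_expand] at h3
  omega

section Galois

variable {K : Type*} [Field K] [Algebra K ℂ] {e : WeierstrassCurve K}

lemma xCoord_map (σ : ℂ ≃ₐ[K] ℂ) (Q : (e.baseChange ℂ).toAffine.Point) :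
    xCoord (W := e.baseChange ℂ) (Affine.Point.map (W' := e) (σ : ℂ →ₐ[K] ℂ) Q) =
      σ (xCoord Q) := by
  cases Q with
  | zero => exact (map_zero σ).symm
  | some x y h => rfl

variable {G : AddSubgroup (e.baseChange ℂ).toAffine.Point}

/-- The permutation of the points of a finite subgroup defined over `K` by an automorphism over
`K`. -/
def galoisPerm [Finite G] (hG : IsDefinedOver e G) (σ : ℂ ≃ₐ[K] ℂ) : G ≃ G :=
  Equiv.ofBijective (fun Q ↦ ⟨Affine.Point.map (W' := e) (σ : ℂ →ₐ[K] ℂ) Q.1, hG σ Q.1 Q.2⟩) <|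
    Finite.injective_iff_bijective.mp fun _ _ h ↦
      Subtype.ext (Affine.Point.map_injective (W' := e) (σ : ℂ →ₐ[K] ℂ) (congrArg Subtype.val h))

lemma xCoord_galoisPerm [Finite G] (hG : IsDefinedOver e G) (σ : ℂ ≃ₐ[K] ℂ) (Q : G) :
    xCoord (galoisPerm hG σ Q : (e.baseChange ℂ).toAffine.Point) = σ (xCoord Q.1) :=
  xCoord_map σ Q.1

lemma galoisPerm_mem_nonzeroPoints [Fintype G] (hG : IsDefinedOver e G) (σ : ℂ ≃ₐ[K] ℂ) (Q : G) :
    galoisPerm hG σ Q ∈ nonzeroPoints G ↔ Q ∈ nonzeroPoints G := by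
  have h0 : galoisPerm hG σ 0 = 0 :=
    Subtype.ext (Affine.Point.map_zero (W' := e) (σ : ℂ →ₐ[K] ℂ))
  simp only [nonzeroPoints, Finset.mem_filter, Finset.mem_univ, true_and, ne_eq]
  rw [← h0, (galoisPerm hG σ).injective.eq_iff, h0]

lemma map_isogDen [Fintype G] (hG : IsDefinedOver e G) (σ : ℂ ≃ₐ[K] ℂ) :
    (isogDen G).map (σ : ℂ →+* ℂ) = isogDen G := by
  rw [isogDen, Polynomial.map_prod]
  refine Finset.prod_equiv (galoisPerm hG σ)
    (fun Q ↦ (galoisPerm_mem_nonzeroPoints hG σ Q).symm) fun Q _ ↦ ?_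
  rw [xCoord_galoisPerm]
  simp

lemma map_translateNum (σ : ℂ ≃ₐ[K] ℂ) (q : ℂ) :
    (translateNum (e.baseChange ℂ) q).map (σ : ℂ →+* ℂ) =
      translateNum (e.baseChange ℂ) (σ q) := by
  have h2 : σ (e.baseChange ℂ).b₂ = (e.baseChange ℂ).b₂ := by
    rw [WeierstrassCurve.baseChange, WeierstrassCurve.map_b₂, σ.commutes]
  have h4 : σ (e.baseChange ℂ).b₄ = (e.baseChange ℂ).b₄ := by
    rw [WeierstrassCurve.baseChange, WeierstrassCurve.map_b₄, σ.commutes]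
  have h6 : σ (e.baseChange ℂ).b₆ = (e.baseChange ℂ).b₆ := by
    rw [WeierstrassCurve.baseChange, WeierstrassCurve.map_b₆, σ.commutes]
  have h : σ 2 = 2 := map_ofNat σ 2
  simp [translateNum, h2, h4, h6, h]

lemma map_isogNum [Fintype G] (hG : IsDefinedOver e G) (σ : ℂ ≃ₐ[K] ℂ) :
    (isogNum G).map (σ : ℂ →+* ℂ) = isogNum G := by
  rw [isogNum, Polynomial.map_add, Polynomial.map_mul, map_X, map_isogDen hG, Polynomial.map_sum]
  congr 1
  refine Finset.sum_equiv (galoisPerm hG σ)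
    (fun Q ↦ (galoisPerm_mem_nonzeroPoints hG σ Q).symm) fun Q _ ↦ ?_
  rw [Polynomial.map_mul, map_translateNum, xCoord_galoisPerm, Polynomial.map_prod]
  congr 1
  refine Finset.prod_equiv (galoisPerm hG σ) (fun Q' ↦ ?_) fun Q' _ ↦ ?_
  · rw [Finset.mem_erase, Finset.mem_erase, galoisPerm_mem_nonzeroPoints, ne_eq, ne_eq,
      (galoisPerm hG σ).injective.eq_iff]
  · rw [xCoord_galoisPerm]
    simp

lemma exists_map_eq_of_fixed [CharZero K] {p : ℂ[X]}
    (hp : ∀ σ : ℂ ≃ₐ[K] ℂ, p.map (σ : ℂ →+* ℂ) = p) : ∃ q : K[X], q.map (algebraMap K ℂ) = p := by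
  refine (mem_lifts p).mp ((lifts_iff_coeff_lifts p).mpr fun n ↦ ?_)
  refine mem_range_of_fixed fun σ ↦ ?_
  have h := congrArg (fun r : ℂ[X] ↦ r.coeff n) (hp σ)
  simp only [coeff_map] at h
  exact h

end Galois

section Descent

variable {K : Type*} [Field K] [CharZero K] [Algebra K ℂ] {e : WeierstrassCurve K}
  [e.IsElliptic]

lemma eq_zero_of_eval_xCoord {W : WeierstrassCurve ℂ} [W.IsElliptic]
    {G : AddSubgroup W.toAffine.Point} [Finite G]
    {p : ℂ[X]} (hp : ∀ P ∉ G, p.eval (xCoord P) = 0) : p = 0 := by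
  refine p.eq_zero_of_infinite_isRoot (Set.Infinite.mono ?_
    ((Set.toFinite (G : Set W.toAffine.Point)).image xCoord).infinite_compl)
  intro x hx
  obtain ⟨v, hv⟩ := IsAlgClosed.exists_pow_nat_eq (cubic W x) two_pos
  obtain ⟨P, -, hPx, -⟩ := exists_point hv
  rw [← hPx]
  exact hp P fun hPG ↦ hx ⟨P, hPG, hPx⟩

lemma IsWeierstrassPair.eq_zero_of_eval_eq_zero {W : WeierstrassCurve ℂ} {L : AddSubgroup ℂ} {κ : ℂ}
    {f g : ℂ → ℂ} (h : IsWeierstrassPair W L κ f g) {p : ℂ[X]} (hp : ∀ z ∉ L, p.eval (f z) = 0) :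
    p = 0 := by
  by_contra hne
  have h1 : ∀ᶠ z in 𝓝[≠] 0, ∀ a ∈ p.roots.toFinset, f z ≠ a :=
    (Filter.eventually_all_finset _).mpr fun a _ ↦ h.eventually_ne a
  obtain ⟨z, hz, hzL⟩ := (h1.and (h.lattice.eventually_notMem 0)).exists
  exact hz _ (by simpa [hne] using hp z hzL) rfl

/-- If a quotient of an elliptic curve over `K` by a finite subgroup that is defined over `K` is
given by Vélu's formulas, then its coefficients lie in `K`. They satisfy a polynomial identity whose
other terms are fixed by the automorphisms over `K`, and which determines them. -/
lemma mem_range_of_isWeierstrassPair_sum {τ : ℍ} {π : ℂ →+ (e.baseChange ℂ).toAffine.Point}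
    (h : IsUniformization (e.baseChange ℂ) τ π) {G : AddSubgroup (e.baseChange ℂ).toAffine.Point}
    [Fintype G] (hG : IsDefinedOver e G) {κ a₂ a₄ a₆ : ℂ}
    (hp : IsWeierstrassPair ⟨0, a₂, 0, a₄, a₆⟩ (G.comap π) κ
      (fun z ↦ ∑ Q : G, xCoord (π z + Q.1))
      (fun z ↦ (isogDerivNum G).eval (xCoord (π z)) / (isogDen G).eval (xCoord (π z)) ^ 2 *
        vCoord (π z))) :
    a₂ ∈ (algebraMap K ℂ).range ∧ a₄ ∈ (algebraMap K ℂ).range ∧ a₆ ∈ (algebraMap K ℂ).range := by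
  have hell : (e.baseChange ℂ).IsElliptic := by
    rw [WeierstrassCurve.baseChange]
    infer_instance
  set n := isogNum G
  set d := isogDen G
  set q := isogDerivNum G with hq
  let cW : ℂ[X] := X ^ 3 + C ((e.baseChange ℂ).b₂ / 4) * X ^ 2 +
    C ((e.baseChange ℂ).b₄ / 2) * X + C ((e.baseChange ℂ).b₆ / 4)
  have hcub : cubic ⟨0, a₂, 0, a₄, a₆⟩ = fun x ↦ x ^ 3 + a₂ * x ^ 2 + a₄ * x + a₆ := by
    funext x
    simp only [cubic, WeierstrassCurve.b₂, WeierstrassCurve.b₄, WeierstrassCurve.b₆]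
    ring
  have hid : q ^ 2 * cW - d * (n ^ 3 + C a₂ * n ^ 2 * d + C a₄ * n * d ^ 2 + C a₆ * d ^ 3) = 0 := by
    refine eq_zero_of_eval_xCoord (G := G) fun P hP ↦ ?_
    obtain ⟨z, rfl⟩ := h.surjective P
    have hd0 : d.eval (xCoord (π z)) ≠ 0 := eval_isogDen_ne_zero hP
    have h1 := hp.sq_eq z hP
    have h0 : π z ≠ 0 := fun h0 ↦ hP (h0 ▸ G.zero_mem)
    simp only [hcub] at h1
    rw [sum_xCoord_add_eq hP, mul_pow, vCoord_sq h0, cubic] at h1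
    change (q.eval _ / d.eval _ ^ 2) ^ 2 * _ = (n.eval _ / d.eval _) ^ 3 +
      a₂ * (n.eval _ / d.eval _) ^ 2 + a₄ * (n.eval _ / d.eval _) + a₆ at h1
    simp only [cW, eval_sub, eval_add, eval_mul, eval_pow, eval_C, eval_X]
    field_simp at h1
    linear_combination h1 / 8
  have key : ∀ σ : ℂ ≃ₐ[K] ℂ, σ a₂ = a₂ ∧ σ a₄ = a₄ ∧ σ a₆ = a₆ := by
    intro σ
    have hn : n.map (σ : ℂ →+* ℂ) = n := map_isogNum hG σ
    have hd : d.map (σ : ℂ →+* ℂ) = d := map_isogDen hG σ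
    have hqm : q.map (σ : ℂ →+* ℂ) = q := by
      change (derivative n * d - n * derivative d).map (σ : ℂ →+* ℂ) =
        derivative n * d - n * derivative d
      rw [Polynomial.map_sub, Polynomial.map_mul, Polynomial.map_mul, ← derivative_map,
        ← derivative_map, hn, hd]
    have hcW : cW.map (σ : ℂ →+* ℂ) = cW := by
      have h2 : σ (e.baseChange ℂ).b₂ = (e.baseChange ℂ).b₂ := by
        rw [WeierstrassCurve.baseChange, WeierstrassCurve.map_b₂, σ.commutes]
      have h4 : σ (e.baseChange ℂ).b₄ = (e.baseChange ℂ).b₄ := by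
        rw [WeierstrassCurve.baseChange, WeierstrassCurve.map_b₄, σ.commutes]
      have h6 : σ (e.baseChange ℂ).b₆ = (e.baseChange ℂ).b₆ := by
        rw [WeierstrassCurve.baseChange, WeierstrassCurve.map_b₆, σ.commutes]
      have e2 : σ 2 = 2 := map_ofNat σ 2
      have e4 : σ 4 = 4 := map_ofNat σ 4
      simp [cW, h2, h4, h6, e2, e4]
    have hid' := congrArg (Polynomial.map (σ : ℂ →+* ℂ)) hid
    simp only [Polynomial.map_sub, Polynomial.map_add, Polynomial.map_mul, Polynomial.map_pow,
      map_C, hn, hd, hqm, hcW, Polynomial.map_zero] at hid'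
    have hdiff : d ^ 2 * (C (σ a₂ - a₂) * n ^ 2 + C (σ a₄ - a₄) * n * d +
        C (σ a₆ - a₆) * d ^ 2) = 0 := by
      simp only [C_sub]
      change _ - d * (n ^ 3 + C (σ a₂) * _ * _ + C (σ a₄) * _ * _ + C (σ a₆) * _) = 0 at hid'
      linear_combination hid - hid'
    have hpol : C (σ a₂ - a₂) * X ^ 2 + C (σ a₄ - a₄) * X + C (σ a₆ - a₆) = 0 := by
      refine hp.eq_zero_of_eval_eq_zero fun z hz ↦ ?_
      have hd0 : d.eval (xCoord (π z)) ≠ 0 := eval_isogDen_ne_zero hz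
      have h1 := congrArg (eval (xCoord (π z))) hdiff
      rw [sum_xCoord_add_eq hz]
      change eval (n.eval _ / d.eval _) _ = 0
      simp only [eval_add, eval_mul, eval_pow, eval_C, eval_X, eval_zero] at h1 ⊢
      have h2 := (mul_eq_zero.mp h1).resolve_left (pow_ne_zero 2 hd0)
      field_simp
      linear_combination h2
    have c2 := congrArg (fun p : ℂ[X] ↦ p.coeff 2) hpol
    have c4 := congrArg (fun p : ℂ[X] ↦ p.coeff 1) hpol
    have c6 := congrArg (fun p : ℂ[X] ↦ p.coeff 0) hpol
    simp [coeff_X, coeff_C, -map_sub] at c2 c4 c6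
    exact ⟨sub_eq_zero.mp c2, sub_eq_zero.mp c4, sub_eq_zero.mp c6⟩
  exact ⟨mem_range_of_fixed fun σ ↦ (key σ).1, mem_range_of_fixed fun σ ↦ (key σ).2.1,
    mem_range_of_fixed fun σ ↦ (key σ).2.2⟩

/-- The quotient of an elliptic curve over `K` by a finite subgroup that is defined over `K` is
defined over `K`, and it is uniformized by the preimage of the subgroup. -/
theorem exists_isogeny {τ : ℍ} {π : ℂ →+ (e.baseChange ℂ).toAffine.Point}
    (h : IsUniformization (e.baseChange ℂ) τ π) {G : AddSubgroup (e.baseChange ℂ).toAffine.Point}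
    [Finite G] (hG : IsDefinedOver e G) :
    ∃ (e' : WeierstrassCurve K) (_ : e'.IsElliptic)
      (ψ : (e.baseChange ℂ).toAffine.Point →+ (e'.baseChange ℂ).toAffine.Point),
      IsIsogeny K ψ ∧ ψ.ker = G ∧
      ∃ κ f g, IsWeierstrassPair (e'.baseChange ℂ) (G.comap π) κ f g := by
  have := Fintype.ofFinite G
  obtain ⟨κ₀, hp⟩ := h.exists_isWeierstrassPair
  obtain ⟨a₂, a₄, a₆, hq⟩ := h.exists_isWeierstrassPair_sum G hp
  obtain ⟨⟨k₂, hk₂⟩, ⟨k₄, hk₄⟩, ⟨k₆, hk₆⟩⟩ := mem_range_of_isWeierstrassPair_sum h hG hq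
  let e' : WeierstrassCurve K := ⟨0, k₂, 0, k₄, k₆⟩
  have he' : e'.baseChange ℂ = ⟨0, a₂, 0, a₄, a₆⟩ := by
    rw [← hk₂, ← hk₄, ← hk₆]
    simp [e', WeierstrassCurve.baseChange, WeierstrassCurve.map]
  rw [← he'] at hq
  have hΔ : e'.Δ ≠ 0 := by
    intro h0
    apply hq.Δ_ne_zero
    rw [WeierstrassCurve.baseChange, WeierstrassCurve.map_Δ, h0, map_zero]
  have hell : e'.IsElliptic := ⟨hΔ.isUnit⟩
  have : (e'.baseChange ℂ).IsElliptic := by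
    rw [WeierstrassCurve.baseChange]
    infer_instance
  obtain ⟨θ, hθ0, hθ⟩ := hq.exists_addMonoidHom
  have hker : π.ker ≤ θ.ker := fun z hz ↦ by
    rw [AddMonoidHom.mem_ker, hθ0]
    change π z ∈ G
    rw [AddMonoidHom.mem_ker.mp hz]
    exact G.zero_mem
  obtain ⟨ψ, hψ⟩ : ∃ ψ : (e.baseChange ℂ).toAffine.Point →+ (e'.baseChange ℂ).toAffine.Point,
      ∀ z, ψ (π z) = θ z :=
    ⟨π.liftOfSurjective h.surjective ⟨θ, hker⟩,
      AddMonoidHom.liftOfRightInverse_comp_apply _ _ _ _⟩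
  have hψ0 : ∀ P, ψ P = 0 ↔ P ∈ G := by
    intro P
    obtain ⟨z, rfl⟩ := h.surjective P
    rw [hψ, hθ0]
    rfl
  obtain ⟨n, hn⟩ := exists_map_eq_of_fixed (map_isogNum hG)
  obtain ⟨d, hd⟩ := exists_map_eq_of_fixed (map_isogDen hG)
  have hnd : (derivative n * d - n * derivative d).map (algebraMap K ℂ) = isogDerivNum G := by
    rw [Polynomial.map_sub, Polynomial.map_mul, Polynomial.map_mul, ← derivative_map,
      ← derivative_map, hn, hd]
    rfl
  have haeval : ∀ (p : K[X]) (x : ℂ), aeval x p = (p.map (algebraMap K ℂ)).eval x :=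
    fun p x ↦ (eval_map_algebraMap p x).symm
  refine ⟨e', hell, ψ, ?_, AddSubgroup.ext hψ0, κ₀, _, _, hq⟩
  refine isIsogeny_of_formula (b₁ := e.a₁) (b₃ := e.a₃) (b₁' := e'.a₁) (b₃' := e'.a₃)
    rfl rfl rfl rfl (G : Set (e.baseChange ℂ).toAffine.Point) (Set.toFinite _) G.zero_mem n d
    (derivative n * d - n * derivative d) fun P hP ↦ ?_
  obtain ⟨z, rfl⟩ := h.surjective P
  have hz : z ∉ G.comap π := hP
  refine ⟨mt (hψ0 _).mp hP, ?_, ?_, ?_⟩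
  · rw [haeval, hd]
    exact eval_isogDen_ne_zero hP
  · rw [haeval, haeval, hn, hd, hψ, (hθ z hz).1, sum_xCoord_add_eq hP]
  · rw [haeval, haeval, hnd, hd, hψ, (hθ z hz).2]

end Descent

/-! ### Complex multiplication -/

lemma mem_closure_one_iff {τ z : ℂ} :
    z ∈ AddSubgroup.closure {1, τ} ↔ ∃ p q : ℤ, z = p + q * τ := by
  rw [AddSubgroup.mem_closure_pair]
  simp [eq_comm]

lemma int_add_mul_eq_iff (τ : ℍ) {p q r s : ℤ} :
    (p + q * τ : ℂ) = r + s * τ ↔ p = r ∧ q = s := by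
  refine ⟨fun h ↦ ?_, by rintro ⟨rfl, rfl⟩; rfl⟩
  have him := congrArg Complex.im h
  simp [τ.im_ne_zero] at him
  subst him
  exact ⟨by exact_mod_cast add_right_cancel h, rfl⟩

/-- The discriminant of an integral quadratic polynomial with a non-real root is negative. -/
lemma discrim_neg_of_upperHalfPlane {τ : ℍ} {a b c : ℤ} (ha : a ≠ 0)
    (hτ : (a * τ ^ 2 + b * τ + c : ℂ) = 0) : b ^ 2 - 4 * a * c < 0 := by
  have him := congrArg Complex.im hτ
  have hre := congrArg Complex.re hτ
  simp [pow_two] at him hre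
  have h1 : (a : ℝ) * (τ.re + τ.re) + b = 0 := by
    apply mul_right_cancel₀ τ.im_ne_zero
    linear_combination him
  have h2 : ((b ^ 2 - 4 * a * c : ℤ) : ℝ) = -(2 * a * τ.im) ^ 2 := by
    push_cast
    linear_combination (b - 2 * a * τ.re) * h1 - 4 * a * hre + 4 * a * τ.re * h1
  have h3 : 0 < (2 * a * τ.im : ℝ) ^ 2 := by
    have : (a : ℝ) ≠ 0 := by exact_mod_cast ha
    have := τ.im_ne_zero
    positivity
  have : ((b ^ 2 - 4 * a * c : ℤ) : ℝ) < 0 := by linarith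
  exact_mod_cast this

/-- The multiplier ring of the lattice `ℤ + ℤ τ`, where `a τ ^ 2 + b τ + c = 0` with `a`, `b` and
`c` coprime, is `ℤ[a τ]`. -/
lemma forall_mul_mem_closure_iff {τ : ℍ} {a b c : ℤ}
    (hprim : ∃ x y z : ℤ, x * a + y * b + z * c = 1)
    (hτ : (a * τ ^ 2 + b * τ + c : ℂ) = 0) (β : ℂ) :
    (∀ z ∈ AddSubgroup.closure {1, (τ : ℂ)}, β * z ∈ AddSubgroup.closure {1, (τ : ℂ)}) ↔
      ∃ u v : ℤ, β = u + v * (a * τ) := by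
  constructor
  · intro h
    obtain ⟨u, w, huw⟩ := mem_closure_one_iff.mp (h 1 (AddSubgroup.subset_closure (by simp)))
    obtain ⟨r, s, hrs⟩ := mem_closure_one_iff.mp (h τ (AddSubgroup.subset_closure (by simp)))
    rw [mul_one] at huw
    have h1 : ((-(w * c) : ℤ) + (a * u - w * b : ℤ) * τ : ℂ) = ((a * r : ℤ) + (a * s : ℤ) * τ) := by
      push_cast
      rw [huw] at hrs
      linear_combination a * hrs - w * hτ
    obtain ⟨h2, h3⟩ := (int_add_mul_eq_iff τ).mp h1
    obtain ⟨x, y, z, hxyz⟩ := hprim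
    refine ⟨u, x * w + y * (u - s) - z * r, ?_⟩
    have h4 : w = (x * w + y * (u - s) - z * r) * a := by
      linear_combination (-w) * hxyz - z * h2 - y * h3
    rw [huw]
    conv_lhs => rw [h4]
    push_cast
    ring
  · rintro ⟨u, v, rfl⟩ z hz
    obtain ⟨p, q, rfl⟩ := mem_closure_one_iff.mp hz
    refine mem_closure_one_iff.mpr ⟨u * p - v * q * c, u * q + v * p * a - v * q * b, ?_⟩
    push_cast
    linear_combination v * q * hτ

/-- A non-zero integral quadratic form is a multiple of a primitive one. -/
lemma exists_primitive {x y z : ℤ} (hx : x ≠ 0) :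
    ∃ g a b c : ℤ, g ≠ 0 ∧ x = g * a ∧ y = g * b ∧ z = g * c ∧
      ∃ u v w : ℤ, u * a + v * b + w * c = 1 := by
  obtain ⟨x', hx'⟩ := Int.gcd_dvd_left x y
  obtain ⟨y', hy'⟩ := Int.gcd_dvd_right x y
  set d : ℤ := ((Int.gcd x y : ℕ) : ℤ) with hd
  obtain ⟨d', hd'⟩ := Int.gcd_dvd_left d z
  obtain ⟨z', hz'⟩ := Int.gcd_dvd_right d z
  have h1 := Int.gcd_eq_gcd_ab x y
  have h2 := Int.gcd_eq_gcd_ab d z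
  set g : ℤ := ((Int.gcd d z : ℕ) : ℤ) with hg
  have hg0 : g ≠ 0 := by
    intro h0
    rw [h0, zero_mul] at hd'
    rw [hd', zero_mul] at hx'
    exact hx hx'
  refine ⟨g, d' * x', d' * y', z', hg0, by rw [← mul_assoc, ← hd']; exact hx',
    by rw [← mul_assoc, ← hd']; exact hy', hz', x.gcdA y * d.gcdA z, x.gcdB y * d.gcdA z,
    d.gcdB z, ?_⟩
  apply mul_left_cancel₀ hg0
  linear_combination (-1) * h2 - d.gcdB z * hz' - d.gcdA z * h1 - d.gcdA z * x.gcdA y * hx' -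
    d.gcdA z * x.gcdB y * hy' - (d.gcdA z * x.gcdA y * x' + d.gcdA z * x.gcdB y * y') * hd'

namespace IsUniformization

variable {W : WeierstrassCurve ℂ} {τ : ℍ} {π : ℂ →+ W.toAffine.Point}

lemma exists_map_ne_zero (h : IsUniformization W τ π) : ∃ z, π z ≠ 0 := by
  obtain ⟨z, hz⟩ := (h.isPeriodLattice.eventually_notMem 0).exists
  exact ⟨z, hz⟩

/-- If `τ` is a root of a primitive integral quadratic form, then the curve uniformized by
`ℤ + ℤ τ` has complex multiplication by the order of the discriminant of that form. -/
theorem hasCMByDiscriminant (h : IsUniformization W τ π) {a b c : ℤ} (ha : a ≠ 0)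
    (hprim : ∃ x y z : ℤ, x * a + y * b + z * c = 1) (hτ : (a * τ ^ 2 + b * τ + c : ℂ) = 0) :
    HasCMByDiscriminant W (b ^ 2 - 4 * a * c) := by
  refine ⟨discrim_neg_of_upperHalfPlane ha hτ, -(a * c), -b, by ring, ?_⟩
  let ρ : QuadraticAlgebra ℤ (-(a * c)) (-b) →ₐ[ℤ] ℂ := QuadraticAlgebra.lift
    ⟨(a * τ : ℂ), by
      simp only [zsmul_eq_mul]
      push_cast
      linear_combination a * hτ⟩
  have hρ : ∀ r, ρ r = r.re + r.im * (a * τ) := fun r ↦ by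
    change r.re • (1 : ℂ) + r.im • (a * τ : ℂ) = _
    simp
  have hρL : ∀ r, ∀ z ∈ π.ker, ρ r * z ∈ π.ker := by
    intro r
    rw [h.ker_eq]
    exact (forall_mul_mem_closure_iff hprim hτ _).mpr ⟨_, _, hρ r⟩
  choose F hF using fun r ↦ h.exists_addMonoidHom_mul (hρL r)
  have hext : ∀ {ψ ψ' : W.toAffine.Point →+ W.toAffine.Point}, (∀ z, ψ (π z) = ψ' (π z)) →
      ψ = ψ' := fun H ↦ AddMonoidHom.ext fun P ↦ by
    obtain ⟨z, rfl⟩ := h.surjective P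
    exact H z
  let f : QuadraticAlgebra ℤ (-(a * c)) (-b) →+* AddMonoid.End W.toAffine.Point :=
    { toFun := F
      map_one' := hext fun z ↦ by
        rw [hF, map_one, one_mul]
        rfl
      map_zero' := hext fun z ↦ by
        rw [hF, map_zero, zero_mul, map_zero]
        rfl
      map_mul' := fun r s ↦ hext fun z ↦ by
        change _ = F r (F s (π z))
        rw [hF, hF, hF, map_mul ρ, mul_assoc]
      map_add' := fun r s ↦ hext fun z ↦ by
        change _ = F r (π z) + F s (π z)
        rw [hF, hF, hF, map_add, add_mul, map_add] }
  have hf0 : ∀ r, F r = 0 → ρ r = 0 := by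
    intro r hr
    by_contra hne
    obtain ⟨z, hz⟩ := h.exists_map_ne_zero
    apply hz
    have h1 := hF r ((ρ r)⁻¹ * z)
    rw [mul_inv_cancel_left₀ hne, hr] at h1
    exact h1.symm
  refine ⟨f, (injective_iff_map_eq_zero f).mpr fun r hr ↦ ?_, fun ψ ↦ ⟨?_, ?_⟩⟩
  · have h1 : ((r.re : ℤ) + (r.im * a : ℤ) * τ : ℂ) = (0 : ℤ) + (0 : ℤ) * τ := by
      have := hf0 r hr
      rw [hρ] at this
      push_cast
      linear_combination this
    obtain ⟨h2, h3⟩ := (int_add_mul_eq_iff τ).mp h1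
    exact QuadraticAlgebra.ext h2 ((mul_eq_zero.mp h3).resolve_right ha)
  · rintro ⟨r, rfl⟩
    by_cases h0 : ρ r = 0
    · left
      refine hext fun z ↦ ?_
      change F r (π z) = 0
      rw [hF, h0, zero_mul, map_zero]
    · exact .inr (h.isIsogeny_of_mul h0 (hρL r) (hF r))
  · rintro (rfl | hψ)
    · exact ⟨0, map_zero f⟩
    · obtain ⟨β, hβ⟩ := h.exists_mul_of_isIsogeny hψ
      have hβL : ∀ z ∈ π.ker, β * z ∈ π.ker := fun z hz ↦ by
        rw [AddMonoidHom.mem_ker, ← hβ, AddMonoidHom.mem_ker.mp hz, map_zero]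
      rw [h.ker_eq] at hβL
      obtain ⟨u, v, huv⟩ := (forall_mul_mem_closure_iff hprim hτ β).mp hβL
      refine ⟨⟨u, v⟩, hext fun z ↦ ?_⟩
      change F ⟨u, v⟩ (π z) = ψ (π z)
      rw [hF, hβ, hρ, huv]

/-- If the quotient of `ℂ / (ℤ + ℤ τ)` by the subgroup generated by `1 / m` is isomorphic to
`ℂ / (ℤ + ℤ τ)`, then the matrix of the isomorphism in terms of the bases `(1 / m, τ)` and `(1, τ)`
has determinant `1`, and `τ` is a root of a quadratic form of discriminant `t ^ 2 - 4 * m`,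
where `t` is the trace of the matrix of the resulting endomorphism. -/
theorem exists_hasCMByDiscriminant (h : IsUniformization W τ π) {m : ℕ} (hm : 1 < m) {α : ℂ}
    (hα : ∀ z : ℂ, α * z ∈ π.ker ↔ π z ∈ AddSubgroup.zmultiples (π (1 / m))) :
    ∃ D : ℤ, HasCMByDiscriminant W D ∧ 0 ≤ -D ∧ -D ≤ 4 * m ∧ IsSquare (D : ZMod (4 * m)) := by
  have hm0 : (m : ℂ) ≠ 0 := by exact_mod_cast (by omega : m ≠ 0)
  have hker : ∀ z, z ∈ π.ker ↔ ∃ p q : ℤ, z = p + q * τ := fun z ↦ by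
    rw [h.ker_eq, mem_closure_one_iff]
  have hL : ∀ z : ℂ, α * z ∈ π.ker ↔ ∃ p q : ℤ, z = p / m + q * τ := by
    intro z
    rw [hα, AddSubgroup.mem_zmultiples_iff]
    constructor
    · rintro ⟨k, hk⟩
      rw [← map_zsmul, eq_comm, ← sub_eq_zero, ← map_sub] at hk
      obtain ⟨p, q, hpq⟩ := (hker _).mp hk
      refine ⟨k + m * p, q, ?_⟩
      rw [eq_add_of_sub_eq hpq, zsmul_eq_mul]
      push_cast
      field_simp
      ring
    · rintro ⟨p, q, rfl⟩
      refine ⟨p, ?_⟩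
      have hq : π (q * τ : ℂ) = 0 := (hker _).mpr ⟨0, q, by simp⟩
      rw [map_add, hq, add_zero, ← map_zsmul]
      congr 1
      simp
      ring
  obtain ⟨A, B, hAB⟩ := (hker _).mp ((hL (1 / m)).mpr ⟨1, 0, by simp⟩)
  obtain ⟨C, D, hCD⟩ := (hker _).mp ((hL τ).mpr ⟨0, 1, by simp⟩)
  have hαm : α = m * A + m * B * τ := by
    field_simp at hAB
    linear_combination hAB
  have hα0 : α ≠ 0 := by
    rintro rfl
    have h1 : ((0 : ℤ) + (0 : ℤ) * τ : ℂ) = (C : ℂ) + D * τ := by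
      linear_combination hCD
    obtain ⟨z, hz⟩ := h.exists_map_ne_zero
    obtain ⟨p, q, hpq⟩ := (hL ((m : ℂ)⁻¹ * z)).mp (by rw [zero_mul]; exact zero_mem _)
    exact hz ((hker z).mpr ⟨p, m * q, by push_cast; field_simp at hpq; linear_combination hpq⟩)
  have hinv : ∀ z ∈ π.ker, ∃ p q : ℤ, z = (p * A + q * C : ℤ) + (p * B + q * D : ℤ) * τ := by
    intro z hz
    obtain ⟨p, q, hpq⟩ := (hL (α⁻¹ * z)).mp (by rwa [mul_inv_cancel_left₀ hα0])
    refine ⟨p, q, ?_⟩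
    have h1 : z = α * (p / m + q * τ) := by
      rw [← hpq, mul_inv_cancel_left₀ hα0]
    push_cast
    rw [h1]
    linear_combination p * hAB + q * hCD
  obtain ⟨p, q, hpq⟩ := hinv 1 ((hker _).mpr ⟨1, 0, by simp⟩)
  obtain ⟨r, s, hrs⟩ := hinv τ ((hker _).mpr ⟨0, 1, by simp⟩)
  obtain ⟨e1, e2⟩ := (int_add_mul_eq_iff τ).mp
    (show ((1 : ℤ) + (0 : ℤ) * τ : ℂ) = _ by rw [← hpq]; simp)
  obtain ⟨e3, e4⟩ := (int_add_mul_eq_iff τ).mp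
    (show ((0 : ℤ) + (1 : ℤ) * τ : ℂ) = _ by rw [← hrs]; simp)
  have hdet : (A * D - B * C) * (p * s - q * r) = 1 := by
    linear_combination (-(r * B + s * D)) * e1 - e4 + (r * A + s * C) * e2
  have hquad : ((m * B : ℤ) * τ ^ 2 + (m * A - D : ℤ) * τ + (-C : ℤ) : ℂ) = 0 := by
    push_cast
    linear_combination hCD - τ * hαm
  have hB : (m * B : ℤ) ≠ 0 := by
    intro h0
    have h1 : B = 0 := (mul_eq_zero.mp h0).resolve_left (by omega)
    obtain ⟨-, h2⟩ := (int_add_mul_eq_iff τ (p := -C) (q := m * A - D) (r := 0) (s := 0)).mp (by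
      rw [h0] at hquad
      push_cast at hquad ⊢
      linear_combination hquad)
    have h3 : (m : ℤ) ∣ 1 := ⟨A * A * (p * s - q * r), by
      linear_combination (-1) * hdet - A * (p * s - q * r) * h2 - C * (p * s - q * r) * h1⟩
    have := Int.le_of_dvd one_pos h3
    omega
  have hneg := discrim_neg_of_upperHalfPlane hB hquad
  -- The determinant is positive, since otherwise the discriminant would be.
  have hdet1 : A * D - B * C = 1 := by
    rcases Int.eq_one_or_neg_one_of_mul_eq_one hdet with h1 | h1
    · exact h1
    · exfalso
      have h2 : (m * A - D) ^ 2 - 4 * (m * B) * (-C) = (m * A + D) ^ 2 + 4 * m := by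
        linear_combination (-4 * m) * h1
      rw [h2] at hneg
      nlinarith [sq_nonneg (m * A + D)]
  obtain ⟨g, a, b, c, hg, ha, hb, hc, hprim⟩ := exists_primitive (y := m * A - D) (z := -C) hB
  have ha0 : a ≠ 0 := by
    rintro rfl
    exact hB (by rw [ha, mul_zero])
  have hτ : (a * τ ^ 2 + b * τ + c : ℂ) = 0 := by
    have hgC : (g : ℂ) ≠ 0 := by exact_mod_cast hg
    apply mul_left_cancel₀ hgC
    rw [ha, hb, hc] at hquad
    push_cast at hquad
    linear_combination hquad
  have hCM := h.hasCMByDiscriminant ha0 hprim hτ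
  have hdisc : g ^ 2 * (b ^ 2 - 4 * a * c) = (m * A + D) ^ 2 - 4 * m := by
    linear_combination (-(m * A - D) - g * b) * hb + 4 * g * c * ha + 4 * m * B * hc - 4 * m * hdet1
  -- `g` is coprime to `m`, since the determinant is `1`, so that `m` divides `a`.
  have hma : (m : ℤ) ∣ a := by
    have hcop : IsCoprime (m : ℤ) g := ⟨A * A, B * c - A * b, by
      linear_combination hdet1 - B * hc + A * hb⟩
    exact hcop.dvd_of_dvd_mul_left ⟨B, by rw [← ha]⟩
  refine ⟨b ^ 2 - 4 * a * c, hCM, by linarith [hCM.1], ?_, (b : ZMod (4 * m)), ?_⟩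
  · have hg1 : 1 ≤ g ^ 2 := Int.add_one_le_iff.mpr (show 0 < g ^ 2 by positivity)
    nlinarith [hCM.1, sq_nonneg (m * A + D)]
  · obtain ⟨a', rfl⟩ := hma
    have h0 : (4 * m : ZMod (4 * m)) = 0 := by exact_mod_cast ZMod.natCast_self (4 * m)
    push_cast
    linear_combination (-(a' * c : ZMod (4 * m))) * h0

end IsUniformization

/-! ### The subgroup of order `m` and the dichotomy -/

namespace IsUniformization

section Torsion

variable {W : WeierstrassCurve ℂ} {τ : ℍ} {π : ℂ →+ W.toAffine.Point}

lemma addOrderOf_map_one_div (h : IsUniformization W τ π) {n : ℕ} (hn : n ≠ 0) :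
    addOrderOf (π (1 / n)) = n := by
  have hn' : (n : ℂ) ≠ 0 := by exact_mod_cast hn
  refine Nat.dvd_antisymm (addOrderOf_dvd_of_nsmul_eq_zero ?_) ?_
  · rw [← map_nsmul, ← AddMonoidHom.mem_ker, nsmul_eq_mul, mul_one_div_cancel hn']
    exact h.isPeriodLattice.one_mem
  · have h1 := addOrderOf_nsmul_eq_zero (π (1 / n))
    rw [← map_nsmul, ← AddMonoidHom.mem_ker, h.ker_eq, mem_closure_one_iff] at h1
    obtain ⟨p, q, hpq⟩ := h1
    set k := addOrderOf (π (1 / n))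
    have h2 : ((k : ℤ) + (0 : ℤ) * τ : ℂ) = (n * p : ℤ) + (n * q : ℤ) * τ := by
      rw [nsmul_eq_mul] at hpq
      field_simp at hpq
      push_cast
      linear_combination hpq
    exact Int.natCast_dvd_natCast.mp ⟨p, ((int_add_mul_eq_iff τ).mp h2).1⟩

lemma mem_zmultiples_and_nsmul_eq_zero_iff (h : IsUniformization W τ π) {N m : ℕ} (hN : N ≠ 0)
    (hm : m ∣ N) (Q : W.toAffine.Point) :
    Q ∈ AddSubgroup.zmultiples (π (1 / N)) ∧ m • Q = 0 ↔
      Q ∈ AddSubgroup.zmultiples (π (1 / m)) := by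
  obtain ⟨d, rfl⟩ := hm
  have hm0 : m ≠ 0 := left_ne_zero_of_mul hN
  have hmC : (m : ℂ) ≠ 0 := by exact_mod_cast hm0
  have hdC : (d : ℂ) ≠ 0 := by exact_mod_cast right_ne_zero_of_mul hN
  have hg : π (1 / m) = d • π (1 / (m * d : ℕ)) := by
    rw [← map_nsmul, nsmul_eq_mul]
    congr 1
    push_cast
    field_simp
  simp only [AddSubgroup.mem_zmultiples_iff]
  constructor
  · rintro ⟨⟨k, rfl⟩, hk⟩
    rw [← natCast_zsmul, ← mul_zsmul, ← addOrderOf_dvd_iff_zsmul_eq_zero,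
      h.addOrderOf_map_one_div hN] at hk
    push_cast at hk
    obtain ⟨l, rfl⟩ := Int.dvd_of_mul_dvd_mul_left (by exact_mod_cast hm0) hk
    refine ⟨l, ?_⟩
    rw [hg, ← natCast_zsmul, ← mul_zsmul, mul_comm]
  · rintro ⟨k, rfl⟩
    refine ⟨⟨k * d, ?_⟩, ?_⟩
    · rw [hg, ← natCast_zsmul, ← mul_zsmul]
    · have h1 := addOrderOf_nsmul_eq_zero (π (1 / m))
      rw [h.addOrderOf_map_one_div hm0] at h1
      rw [smul_comm, h1, smul_zero]

end Torsion

/-- If the quotient of `W` by a subgroup `G` is isomorphic to `W`, then the preimage of `G` in `ℂ`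
is homothetic to the period lattice of `W`. -/
lemma exists_homothety {W W' : WeierstrassCurve ℂ} [W.IsElliptic] {τ : ℍ}
    {π : ℂ →+ W.toAffine.Point} (h : IsUniformization W τ π) {L : AddSubgroup ℂ} {κ : ℂ}
    {f g : ℂ → ℂ} (hp : IsWeierstrassPair W' L κ f g) {C : VariableChange ℂ} (hC : C • W = W') :
    ∃ α : ℂ, ∀ z, α * z ∈ π.ker ↔ z ∈ L := by
  subst hC
  have hq := hp.of_variableChange C
  obtain ⟨θ, hθ0, hθ⟩ := hq.exists_addMonoidHom
  obtain ⟨z₀, hv₀, hz₀⟩ := (hq.eventually_g_ne.and (hq.lattice.eventually_notMem 0)).exists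
  have hnear := hq.lattice.eventually_notMem_nhds hz₀
  obtain ⟨α, hα⟩ := h.exists_eq_mul (θ := θ) (z₀ := z₀)
    ((hq.even.differentiableAt z₀ hz₀).congr_of_eventuallyEq
      (hnear.mono fun z hz ↦ (hθ z hz).1))
    ((hq.differentiableAt_g hz₀).continuousAt.congr
      (hnear.mono fun z hz ↦ (hθ z hz).2.symm))
    (by rwa [(hθ z₀ hz₀).2])
  refine ⟨α, fun z ↦ ?_⟩
  rw [AddMonoidHom.mem_ker, ← hα, hθ0]

end IsUniformization

end ModularPoint

end

theorem theorem1p2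
    (E : WeierstrassCurve ℚ) [E.IsElliptic] (N : ℕ) (hN : ModularPoint.IsConductor E N)
    (φ : ModularPoint.Y0 N → (E.baseChange ℂ).toAffine.Point)
    (hφ : ModularPoint.IsModularParametrization E N φ)
    (P : (E.baseChange ℂ).toAffine.Point) (x₀ : ModularPoint.Y0 N) (hP : φ x₀ = P)
    (K : Type*) [Field K] [NumberField K] [Algebra K ℂ]
    (e : WeierstrassCurve K) [e.IsElliptic]
    (c : AddSubgroup (e.baseChange ℂ).toAffine.Point)
    (hc : ModularPoint.IsDefinedOver e c)
    (hec : ModularPoint.CorrespondsTo x₀ (e.baseChange ℂ) c)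
    (m : ℕ) (hm : m ∣ N) (hm' : Nat.Coprime m (N / m)) :
    (∃ (e' : WeierstrassCurve K) (_ : e'.IsElliptic)
        (ψ : (e.baseChange ℂ).toAffine.Point →+ (e'.baseChange ℂ).toAffine.Point),
        ModularPoint.IsCyclicIsogeny K m ψ ∧
        (∀ Q, ψ Q = 0 ↔ Q ∈ c ∧ m • Q = 0) ∧
        (1 < m → ¬ ∃ C : WeierstrassCurve.VariableChange ℂ,
          C • e.baseChange ℂ = e'.baseChange ℂ)) ∨
      ∃ D : ℤ, ModularPoint.HasCMByDiscriminant (e.baseChange ℂ) D ∧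
        0 ≤ -D ∧ -D ≤ 4 * m ∧ IsSquare (D : ZMod (4 * m)) := by
  obtain ⟨τ, -, π, h, rfl⟩ := hec
  have hm0 : m ≠ 0 := fun h0 ↦ hN.1 (zero_dvd_iff.mp (h0 ▸ hm))
  have hell : (e.baseChange ℂ).IsElliptic := by
    rw [WeierstrassCurve.baseChange]
    infer_instance
  have hmem := h.mem_zmultiples_and_nsmul_eq_zero_iff hN.1 hm
  have hcard : Nat.card (AddSubgroup.zmultiples (π (1 / m))) = m := by
    rw [Nat.card_zmultiples, h.addOrderOf_map_one_div hm0]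
  have hfin : Finite (AddSubgroup.zmultiples (π (1 / m))) :=
    Nat.finite_of_card_ne_zero (by rwa [hcard])
  have hG : ModularPoint.IsDefinedOver e (AddSubgroup.zmultiples (π (1 / m))) := by
    intro σ Q hQ
    obtain ⟨h1, h2⟩ := (hmem Q).mpr hQ
    refine (hmem _).mp ⟨hc σ Q h1, ?_⟩
    have := congrArg (WeierstrassCurve.Affine.Point.map (W' := e) (σ : ℂ →ₐ[K] ℂ)) h2
    rwa [map_nsmul, map_zero] at this
  obtain ⟨e', he', ψ, hψ, hker, κ, f, g, hp⟩ := ModularPoint.exists_isogeny h hG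
  by_cases hiso : 1 < m ∧ ∃ C : WeierstrassCurve.VariableChange ℂ,
      C • e.baseChange ℂ = e'.baseChange ℂ
  · obtain ⟨hm1, C, hC⟩ := hiso
    obtain ⟨α, hα⟩ := h.exists_homothety hp hC
    exact .inr (h.exists_hasCMByDiscriminant hm1 hα)
  · refine .inl ⟨e', he', ψ, ⟨hψ, ?_, ?_⟩, fun Q ↦ ?_, fun hm1 hC ↦ hiso ⟨hm1, hC⟩⟩
    · rw [hker]
      infer_instance
    · rw [hker, hcard]
    · rw [hmem, ← hker, AddMonoidHom.mem_ker]
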